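/- Let $\ell>0$, $\xi\in(-\ell,\ell)$, $a_+<0<a_-$, $\bar\varepsilon>0$, and let $a^0(x)=a_-$ for $x<\xi$, $a^0(x)=a_+$ for $x>\xi$. Let $\{a^\varepsilon\}_{0<\varepsilon<\bar\varepsilon}$ be a family of continuous real functions on $[-\ell,\ell]$ such that: * **A0.** there is $C>0$, independent of $\varepsilon$, with $|a^\varepsilon|_\infty+\varepsilon\left|\frac{da^\varepsilon}{dx}\right|_\infty\le C$ (the second supremum being over $x\in(-\ell,\ell)$, $x\ne\xi$); * **A1.** for every $\varepsilon$, $a^\varepsilon$ is twice differentiable at every $x\in(-\ell,\ell)$, $x\neq\xi$, with $\frac{da^\varepsilon}{dx},\frac{d^2a^\varepsilon}{dx^2}<0<a^\varepsilon$ in $(-\ell,\xi)$ and $a^\varepsilon,\frac{da^\varepsilon}{dx}<0<\frac{d^2a^\varepsilon}{dx^2}$ in $(\xi,\ell)$; * **A2.** for every $C>0$ there is $c_0>0$, independent of $\varepsilon$, such that $|a^\varepsilon(x)-a^0(x)|\le C$ and $\varepsilon\left|\frac{da^\varepsilon}{dx}(x)\right|\le C$ for all $x\in(-\ell,\ell)$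 with $|x-\xi|\ge c_0\varepsilon$; * **A3.** the left and right derivatives $\frac{da^\varepsilon}{dx}(\xi\pm)$ of $a^\varepsilon$ at $\xi$ exist and $\liminf_{\varepsilon\to0^+}\varepsilon\left|\frac{da^\varepsilon}{dx}(\xi\pm)\right|>0$ for both signs. Consider the operator $\mathcal L^\varepsilon u=\varepsilon u''-(a^\varepsilon u)'$ on $(-\ell,\ell)$ with boundary conditions $u(\pm\ell)=0$. Then there exist $C>0$ and $\varepsilon_0\in(0,\bar\varepsilon]$ such that, for every $\varepsilon\in(0,\varepsilon_0)$, the eigenvalues of $\mathcal L^\varepsilon$ (sought among the complex numbers) are all real, have one-dimensional eigenspaces, and form a sequence $\lambda_1^\varepsilon>\lambda_2^\varepsilon>\lambda_3^\varepsilon>\cdots$, and $$-C\,e^{-C/\varepsilon}\le\lambda_1^\varepsilon<0,\qquad \lambda_k^\varepsilon\le -\frac{C}{\varepsilon}\quad\text{for every }k\ge2.$$ -/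

import Mathlib

open Set Filter Topology

/-- The limiting step function: `aL` to the left of `ξ` and `aR` to the right of `ξ`. -/
noncomputable def stepCoeff (ξ aL aR x : ℝ) : ℝ := if x < ξ then aL else aR

/-- `|a^ε|_∞ + ε |da^ε/dx|_∞ ≤ C` with `C` independent of `ε ∈ (0, εbar)`;
the derivative is taken at the points of `(-ℓ, ℓ)` other than `ξ`. -/
def UniformlyBoundedFamily (ℓ ξ εbar : ℝ) (a : ℝ → ℝ → ℝ) : Prop :=
  ∃ C > 0, ∀ ε ∈ Ioo 0 εbar, ∀ x ∈ Icc (-ℓ) ℓ, ∀ y ∈ Ioo (-ℓ) ℓ, y ≠ ξ →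
    |a ε x| + ε * |deriv (a ε) y| ≤ C

/-- A continuous function on `[-ℓ, ℓ]`, twice differentiable in `(-ℓ, ℓ)` away from `ξ`, which is
positive, decreasing and concave (through the signs of its derivatives) on `(-ℓ, ξ)`, and
negative, decreasing and convex on `(ξ, ℓ)`. -/
structure HasLayerShape (ℓ ξ : ℝ) (a : ℝ → ℝ) : Prop where
  continuousOn : ContinuousOn a (Icc (-ℓ) ℓ)
  differentiableAt : ∀ x ∈ Ioo (-ℓ) ℓ, x ≠ ξ → DifferentiableAt ℝ a x
  differentiableAt_deriv : ∀ x ∈ Ioo (-ℓ) ℓ, x ≠ ξ → DifferentiableAt ℝ (deriv a) x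
  left : ∀ x ∈ Ioo (-ℓ) ξ, deriv a x < 0 ∧ deriv (deriv a) x < 0 ∧ 0 < a x
  right : ∀ x ∈ Ioo ξ ℓ, a x < 0 ∧ deriv a x < 0 ∧ 0 < deriv (deriv a) x

/-- Outside a layer of width `O(ε)` around `ξ`, the function `a^ε` is close to the step function and
`ε da^ε/dx` is small, uniformly in `ε`. -/
def ConvergesOutsideLayer (ℓ ξ aL aR εbar : ℝ) (a : ℝ → ℝ → ℝ) : Prop :=
  ∀ C > 0, ∃ c₀ > 0, ∀ ε ∈ Ioo 0 εbar, ∀ x ∈ Ioo (-ℓ) ℓ, c₀ * ε ≤ |x - ξ| →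
    |a ε x - stepCoeff ξ aL aR x| ≤ C ∧ ε * |deriv (a ε) x| ≤ C

/-- The left and right first derivatives of `a^ε` at `ξ` exist, and the lower limits of `ε` times
their absolute values are positive as `ε → 0⁺` (the lower limit is taken in the extended reals). -/
structure HasNondegenerateSlopes (ξ εbar : ℝ) (a : ℝ → ℝ → ℝ) : Prop where
  left : ∀ ε ∈ Ioo 0 εbar, DifferentiableWithinAt ℝ (a ε) (Iio ξ) ξ
  right : ∀ ε ∈ Ioo 0 εbar, DifferentiableWithinAt ℝ (a ε) (Ioi ξ) ξ
  liminf_left :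
    0 < liminf (fun ε : ℝ => ((ε * |derivWithin (a ε) (Iio ξ) ξ| : ℝ) : EReal)) (𝓝[>] 0)
  liminf_right :
    0 < liminf (fun ε : ℝ => ((ε * |derivWithin (a ε) (Ioi ξ) ξ| : ℝ) : EReal)) (𝓝[>] 0)

/-- `u` is a (complex) eigenfunction, with eigenvalue `z`, of the operator
`L u = ε u'' - (a u)'` on `(-ℓ, ℓ)` with boundary conditions `u(±ℓ) = 0`.

As `a` may have a corner, the equation is written as `(ε u' - a u)' = z u`, everywhere in
`(-ℓ, ℓ)`. Where `a` is differentiable this is `ε u'' - (a u)' = z u`. For `a` Lipschitz on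
`[-ℓ, ℓ]` these are precisely the (continuous representatives of) nonzero `u ∈ H² ∩ H¹₀` with
`ε u'' - (a u)' = z u` almost everywhere: the flux `ε u' - a u` of such a function is absolutely
continuous with continuous derivative `z u`; conversely `ε u' - a u` is Lipschitz, hence so
is `u'`. -/
structure IsDirichletEigenfunction (ℓ ε : ℝ) (a : ℝ → ℝ) (z : ℂ) (u : ℝ → ℂ) : Prop where
  continuousOn : ContinuousOn u (Icc (-ℓ) ℓ)
  boundary_left : u (-ℓ) = 0
  boundary_right : u ℓ = 0
  nonzero : ∃ x ∈ Icc (-ℓ) ℓ, u x ≠ 0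
  differentiableAt : ∀ x ∈ Ioo (-ℓ) ℓ, DifferentiableAt ℝ u x
  equation : ∀ x ∈ Ioo (-ℓ) ℓ,
    HasDerivAt (fun y : ℝ => (ε : ℂ) * deriv u y - (a y : ℂ) * u y) (z * u x) x

/-- The set of all (complex) eigenvalues of `L u = ε u'' - (a u)'`, `u(±ℓ) = 0`. -/
def dirichletEigenvalues (ℓ ε : ℝ) (a : ℝ → ℝ) : Set ℂ :=
  {z | ∃ u, IsDirichletEigenfunction ℓ ε a z u}

/-- `lam 1 > lam 2 > lam 3 > ⋯` is the complete list of the eigenvalues of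
`L u = ε u'' - (a u)'`, `u(±ℓ) = 0`: all of them are real, with one-dimensional eigenspaces
(so that listing them with or without multiplicity is the same). There is at most one such
sequence. -/
structure IsEigenvalueSequence (ℓ ε : ℝ) (a : ℝ → ℝ) (lam : ℕ+ → ℝ) : Prop where
  strictAnti : StrictAnti lam
  range_eq : range (fun k => (lam k : ℂ)) = dirichletEigenvalues ℓ ε a
  simple : ∀ k u v, IsDirichletEigenfunction ℓ ε a (lam k) u →
    IsDirichletEigenfunction ℓ ε a (lam k) v → ∃ c : ℂ, ∀ x ∈ Icc (-ℓ) ℓ, v x = c * u x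

/-! Let `A' = a` with `A ξ = 0`, and put `p = exp (A / ε)`, a weight that peaks at `ξ`. The
substitution `u = p v` gives `ε u' - a u = ε p v'`, so the eigenvalue problem becomes the
Sturm–Liouville problem `(p v')' + μ p v = 0`, `v (±ℓ) = 0`, with eigenvalue `-ε μ`. Integrating `v̄
p v'` shows that `μ` is real and positive (`exists_pos_of_ends_eq_zero`).

In Prüfer coordinates `v = ρ sin θ`, `p v' = ρ cos θ`, the end angle `θ ℓ` is continuous, strictly
increasing and unbounded above in `μ`, and is below `π` at `μ = 0`. Hence there is exactly one `μ`
with `θ ℓ = k π` for each `k ≥ 1`, and these are all the eigenvalues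
(`exists_isEigenvalueSequence`).

The first eigenfunction is positive, and its logarithmic derivative satisfies a Riccati equation;
integrating it bounds `μ` by the size of `p` near the ends over the mass of `p` near `ξ`
(`mul_le_of_pos`). The former is exponentially small and the latter of order at least `ε`.

For `k ≥ 2` the eigenfunction has an interior zero, so it solves a Dirichlet problem on an interval
lying on one side of `ξ`. There `a` has a fixed sign and vanishes at most within `O(ε)` of `ξ`, and
an explicit Riccati subsolution gives `μ ≥ κ / ε²` (`le_of_riccati`, `le_of_one_side`). -/

/-! ### Integrating factors and monotonicity. -/

lemma exists_integrating_factor {l r : ℝ} (hlr : l ≤ r) {g : ℝ → ℝ}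
    (hg : ContinuousOn g (Icc l r)) :
    ∃ E : ℝ → ℝ, E l = 1 ∧ (∀ x, 0 < E x) ∧ ∀ x ∈ Icc l r, HasDerivAt E (g x * E x) x := by
  have hG : Continuous (IccExtend hlr ((Icc l r).domRestrict g)) := hg.domRestrict.Icc_extend'
  refine ⟨fun x => Real.exp (∫ t in l..x, IccExtend hlr ((Icc l r).domRestrict g) t), by simp,
    fun x => Real.exp_pos _, fun x hx => ?_⟩
  have h := (hG.integral_hasStrictDerivAt l x).hasDerivAt.exp
  rw [IccExtend_of_mem hlr _ hx, domRestrict_apply, mul_comm] at h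
  exact h

/-- Turns `D' = g D + h` into `(E D)' = E h`, so that the sign of `h` controls the sign of `D`. All
Prüfer comparisons below take this form. -/
lemma exists_integrating_factor_mul {l r : ℝ} (hlr : l ≤ r) {D g h : ℝ → ℝ}
    (hg : ContinuousOn g (Icc l r))
    (hD : ∀ x ∈ Icc l r, HasDerivAt D (g x * D x + h x) x) :
    ∃ E : ℝ → ℝ, (∀ x, 0 < E x) ∧
      ∀ x ∈ Icc l r, HasDerivAt (fun x => E x * D x) (E x * h x) x := by
  obtain ⟨E, -, hpos, hE⟩ := exists_integrating_factor hlr hg.neg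
  refine ⟨E, hpos, fun x hx => ?_⟩
  refine ((hE x hx).mul (hD x hx)).congr_deriv ?_
  simp only [Pi.neg_apply]
  ring

lemma monotoneOn_Icc_of_hasDerivAt {l r : ℝ} {f f' : ℝ → ℝ}
    (hf : ∀ x ∈ Icc l r, HasDerivAt f (f' x) x) (h : ∀ x ∈ Ioo l r, 0 ≤ f' x) :
    MonotoneOn f (Icc l r) := by
  refine monotoneOn_of_hasDerivWithinAt_nonneg (convex_Icc l r) (f' := f')
    (fun x hx => (hf x hx).continuousAt.continuousWithinAt) ?_ ?_
  · intro x hx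
    exact (hf x (interior_subset hx)).hasDerivWithinAt
  · intro x hx
    rw [interior_Icc] at hx
    exact h x hx

lemma strictMonoOn_Icc_of_hasDerivAt {l r : ℝ} {f f' : ℝ → ℝ}
    (hf : ∀ x ∈ Icc l r, HasDerivAt f (f' x) x) (h : ∀ x ∈ Ioo l r, 0 < f' x) :
    StrictMonoOn f (Icc l r) := by
  refine strictMonoOn_of_deriv_pos (convex_Icc l r)
    (fun x hx => (hf x hx).continuousAt.continuousWithinAt) ?_
  intro x hx
  rw [interior_Icc] at hx
  rw [(hf x (Ioo_subset_Icc_self hx)).deriv]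
  exact h x hx

lemma hasDerivAt_eq_zero_of_eqOn_Ioo {E : Type*} [NormedAddCommGroup E] [NormedSpace ℝ E]
    {l r : ℝ} {f : ℝ → E} {f' : E} (h0 : ∀ x ∈ Ioo l r, f x = 0)
    {x : ℝ} (hx : x ∈ Ioo l r) (hf : HasDerivAt f f' x) : f' = 0 := by
  have h : f =ᶠ[𝓝 x] fun _ => 0 := by
    filter_upwards [Ioo_mem_nhds hx.1 hx.2] with y hy using h0 y hy
  exact (hf.congr_of_eventuallyEq h.symm).unique (hasDerivAt_const x 0)

/-- A monotone function with equal values at the two ends has vanishing derivative inside. -/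
lemma deriv_eq_zero_of_nonneg_of_ends_eq {l r : ℝ} {f f' : ℝ → ℝ}
    (hf : ∀ x ∈ Icc l r, HasDerivAt f (f' x) x) (h : ∀ x ∈ Ioo l r, 0 ≤ f' x)
    (hlr : f l = f r) : ∀ x ∈ Ioo l r, f' x = 0 := by
  intro x hx
  have hm := monotoneOn_Icc_of_hasDerivAt hf h
  have hle : l ≤ r := (hx.1.trans hx.2).le
  have h0 : ∀ y ∈ Ioo l r, f y - f l = 0 := fun y hy => by
    have h1 := hm (left_mem_Icc.2 hle) (Ioo_subset_Icc_self hy) hy.1.le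
    have h2 := hm (Ioo_subset_Icc_self hy) (right_mem_Icc.2 hle) hy.2.le
    linarith
  exact hasDerivAt_eq_zero_of_eqOn_Ioo h0 hx ((hf x (Ioo_subset_Icc_self hx)).sub_const (f l))

/-! ### The Prüfer angle. -/

/-- The right-hand side of the Prüfer equation of `(p v')' + μ p v = 0`. -/
noncomputable def prueferField (p : ℝ → ℝ) (μ x θ : ℝ) : ℝ :=
  Real.cos θ ^ 2 / p x + μ * p x * Real.sin θ ^ 2

lemma prueferField_eq (p : ℝ → ℝ) (μ x θ : ℝ) :
    prueferField p μ x θ = 1 / p x + (μ * p x - 1 / p x) * Real.sin θ ^ 2 := by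
  rw [prueferField, Real.cos_sq']
  ring

lemma sin_eq_mul_sinc (x : ℝ) : Real.sin x = x * Real.sinc x := by
  rcases eq_or_ne x 0 with rfl | hx
  · simp
  · rw [Real.sinc_of_ne_zero hx]
    field_simp

lemma sin_sq_sub_sin_sq (x y : ℝ) :
    Real.sin x ^ 2 - Real.sin y ^ 2 = Real.sin (x - y) * Real.sin (x + y) := by
  rw [Real.sin_sub, Real.sin_add]
  linear_combination -Real.sin x ^ 2 * Real.sin_sq_add_cos_sq y
    + Real.sin y ^ 2 * Real.sin_sq_add_cos_sq x

/-- Makes the difference of two angles solve a linear equation. Writing the difference quotient of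
`sin ^ 2` with `sinc` keeps its coefficient continuous where the angles meet. -/
lemma prueferField_sub (p : ℝ → ℝ) (μ ν x θ φ : ℝ) :
    prueferField p ν x φ - prueferField p μ x θ =
      (ν * p x - 1 / p x) * Real.sinc (φ - θ) * Real.sin (φ + θ) * (φ - θ) +
        (ν - μ) * p x * Real.sin θ ^ 2 := by
  rw [prueferField_eq, prueferField_eq]
  have h := sin_sq_sub_sin_sq φ θ
  rw [sin_eq_mul_sinc (φ - θ)] at h
  linear_combination (ν * p x - 1 / p x) * h

lemma exists_bounds_on_Icc {l r : ℝ} (hlr : l ≤ r) {p : ℝ → ℝ} (hp : Continuous p)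
    (hpos : ∀ x, 0 < p x) :
    ∃ m > 0, ∃ M > 0, ∀ x ∈ Icc l r, m ≤ p x ∧ p x ≤ M := by
  obtain ⟨x₁, -, h₁⟩ := isCompact_Icc.exists_isMinOn (nonempty_Icc.2 hlr) hp.continuousOn
  obtain ⟨x₂, -, h₂⟩ := isCompact_Icc.exists_isMaxOn (nonempty_Icc.2 hlr) hp.continuousOn
  exact ⟨p x₁, hpos _, p x₂, hpos _, fun x hx => ⟨h₁ hx, h₂ hx⟩⟩

lemma prueferField_abs_sub_le {p : ℝ → ℝ} {m M μ x : ℝ} (hm : 0 < m) (hx : m ≤ p x)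
    (hx' : p x ≤ M) (θ φ : ℝ) :
    |prueferField p μ x φ - prueferField p μ x θ| ≤ (|μ| * M + 1 / m) * |φ - θ| := by
  have hp : 0 < p x := hm.trans_le hx
  rw [prueferField_sub, sub_self, zero_mul, zero_mul, add_zero, abs_mul, abs_mul, abs_mul]
  have h1 : |μ * p x - 1 / p x| ≤ |μ| * M + 1 / m := by
    refine (abs_sub _ _).trans ?_
    rw [abs_mul, abs_of_pos hp, abs_of_pos (one_div_pos.2 hp)]
    gcongr
  have h2 := Real.abs_sinc_le_one (φ - θ)
  have h3 := Real.abs_sin_le_one (φ + θ)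
  have h0 : 0 ≤ |μ| * M + 1 / m := (abs_nonneg _).trans h1
  calc _ ≤ (|μ| * M + 1 / m) * 1 * 1 * |φ - θ| := by gcongr
    _ = _ := by ring

structure IsPrueferAngle (p : ℝ → ℝ) (μ l r : ℝ) (θ : ℝ → ℝ) : Prop where
  init : θ l = 0
  hasDerivAt : ∀ x ∈ Icc l r, HasDerivAt θ (prueferField p μ x (θ x)) x

namespace IsPrueferAngle

variable {p : ℝ → ℝ} {l r μ : ℝ} {θ : ℝ → ℝ}

lemma continuousOn (hθ : IsPrueferAngle p μ l r θ) : ContinuousOn θ (Icc l r) :=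
  fun x hx => (hθ.hasDerivAt x hx).continuousAt.continuousWithinAt

lemma exists_angle (hlr : l ≤ r) (hp : Continuous p) (hpos : ∀ x, 0 < p x) (μ : ℝ) :
    ∃ θ, IsPrueferAngle p μ l r θ := by
  -- Solving on a larger interval gives two-sided derivatives at `l` and `r`.
  obtain ⟨m, hm, M, hM, hb⟩ := exists_bounds_on_Icc (l := l - 1) (r := r + 1) (by linarith) hp hpos
  have hK : 0 ≤ |μ| * M + 1 / m := by positivity
  have ht : l ∈ Icc (l - 1) (r + 1) := ⟨by linarith, by linarith⟩
  have hT : 0 ≤ (|μ| * M + 1 / m) * (r + 1 - l) := mul_nonneg hK (by linarith)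
  have hPL : IsPicardLindelof (prueferField p μ) (⟨l, ht⟩ : Icc (l - 1) (r + 1)) 0
      ⟨_, hT⟩ 0 ⟨_, hK⟩ ⟨_, hK⟩ := by
    refine ⟨fun t ht => ?_, fun x _ => ?_, fun t ht x _ => ?_, ?_⟩
    · refine LipschitzOnWith.of_dist_le_mul fun x _ y _ => ?_
      rw [Real.dist_eq, Real.dist_eq]
      exact prueferField_abs_sub_le hm (hb t ht).1 (hb t ht).2 y x
    · have : ∀ t, p t ≠ 0 := fun t => (hpos t).ne'
      unfold prueferField
      fun_prop (disch := assumption)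
    · have hpt := hpos t
      have h1 := hb t ht
      have hs := Real.sin_sq_le_one x
      have hc := Real.cos_sq_le_one x
      refine (norm_add_le _ _).trans ?_
      rw [Real.norm_eq_abs, Real.norm_eq_abs, abs_div, abs_mul, abs_mul, abs_of_pos hpt,
        abs_of_nonneg (sq_nonneg _), abs_of_nonneg (sq_nonneg (Real.sin x))]
      change _ ≤ |μ| * M + 1 / m
      rw [add_comm]
      refine add_le_add ?_ ?_
      · calc |μ| * p t * Real.sin x ^ 2 ≤ |μ| * M * 1 := by gcongr; exact h1.2
          _ = _ := mul_one _
      · gcongr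
        exact h1.1
    · change (|μ| * M + 1 / m) * max (r + 1 - l) (l - (l - 1)) ≤
        (|μ| * M + 1 / m) * (r + 1 - l) - 0
      rw [max_eq_left (by linarith), sub_zero]
  obtain ⟨θ, h0, hθ⟩ := hPL.exists_eq_forall_mem_Icc_hasDerivWithinAt₀
  exact ⟨θ, h0, fun x hx => (hθ x ⟨by linarith [hx.1], by linarith [hx.2]⟩).hasDerivAt
    (Icc_mem_nhds (by linarith [hx.1]) (by linarith [hx.2]))⟩

/-- A Prüfer angle crosses multiples of `π` only upwards. -/
lemma lt_of_le_of_sin_eq_zero (hθ : IsPrueferAngle p μ l r θ) (hp : Continuous p)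
    (hpos : ∀ x, 0 < p x) {c : ℝ} (hc : Real.sin c = 0) {x y : ℝ} (hx : x ∈ Icc l r)
    (hy : y ∈ Icc l r) (hxy : x < y) (hcx : c ≤ θ x) : c < θ y := by
  have hne : ∀ t, p t ≠ 0 := fun t => (hpos t).ne'
  have hcont := hθ.continuousOn
  -- Since `sin c = 0`, the constant `c` misses the equation by exactly the positive source `1 / p`.
  obtain ⟨E, hE, hED⟩ := exists_integrating_factor_mul (hx.1.trans hx.2) (D := fun x => θ x - c)
    (g := fun x => (μ * p x - 1 / p x) * Real.sinc (θ x - c) * Real.sin (θ x + c))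
    (h := fun x => 1 / p x) (by
      have := Real.continuous_sinc
      fun_prop (disch := simp [hne])) (fun x hx => by
      refine ((hθ.hasDerivAt x hx).sub_const c).congr_deriv ?_
      have h1 := prueferField_sub p μ μ x c (θ x)
      have h2 := prueferField_eq p μ x c
      rw [hc] at h1 h2
      linear_combination h1 + h2)
  have hm := strictMonoOn_Icc_of_hasDerivAt hED
    (fun x _ => mul_pos (hE x) (one_div_pos.2 (hpos x))) hx hy hxy
  have h0 : 0 ≤ E x * (θ x - c) := mul_nonneg (hE x).le (by linarith)
  have := pos_of_mul_pos_right (h0.trans_lt hm) (hE y).le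
  linarith

lemma pos (hθ : IsPrueferAngle p μ l r θ) (hp : Continuous p) (hpos : ∀ x, 0 < p x)
    {x : ℝ} (hx : x ∈ Ioc l r) : 0 < θ x :=
  hθ.lt_of_le_of_sin_eq_zero hp hpos Real.sin_zero (left_mem_Icc.2 (hx.1.le.trans hx.2))
    ⟨hx.1.le, hx.2⟩ hx.1 hθ.init.ge

/-- For `μ = 0` the constant `π / 2` is itself a solution, and an angle starting at `0` cannot reach
it. -/
lemma lt_pi_of_zero (hθ : IsPrueferAngle p 0 l r θ) (hlr : l ≤ r) (hp : Continuous p)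
    (hpos : ∀ x, 0 < p x) : θ r < Real.pi := by
  have hne : ∀ t, p t ≠ 0 := fun t => (hpos t).ne'
  have hcont := hθ.continuousOn
  obtain ⟨E, hE, hED⟩ := exists_integrating_factor_mul hlr (D := fun x => θ x - Real.pi / 2)
    (g := fun x => -(1 / p x) * Real.sinc (θ x - Real.pi / 2) * Real.sin (θ x + Real.pi / 2))
    (h := fun x => 0) (by
      have := Real.continuous_sinc
      fun_prop (disch := simp [hne])) (fun x hx => by
      refine ((hθ.hasDerivAt x hx).sub_const _).congr_deriv ?_
      have h1 := prueferField_sub p 0 0 x (Real.pi / 2) (θ x)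
      have h2 := prueferField_eq p 0 x (Real.pi / 2)
      rw [Real.sin_pi_div_two] at h2
      linear_combination h1 + h2)
  have hm := monotoneOn_Icc_of_hasDerivAt (f := fun x => -(E x * (θ x - Real.pi / 2)))
    (f' := fun x => -(E x * 0)) (fun x hx => (hED x hx).neg)
    (fun x _ => by simp) (left_mem_Icc.2 hlr) (right_mem_Icc.2 hlr) hlr
  simp only [hθ.init] at hm
  have h0 : 0 < E l * (Real.pi / 2) := mul_pos (hE l) (by positivity)
  have : 0 < E r * (Real.pi / 2 - θ r) := by linarith
  have := pos_of_mul_pos_right this (hE r).le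
  linarith [Real.pi_pos]

/-- Where `sin θ` vanishes, `θ' = 1 / p > 0` and `cos θ ≠ 0`, so the zeros of `sin θ` cannot fill an
interval. -/
lemma exists_sin_ne_zero (hθ : IsPrueferAngle p μ l r θ) (hpos : ∀ x, 0 < p x) {l' r' : ℝ}
    (hl : l ≤ l') (hlr : l' < r') (hr : r' ≤ r) : ∃ x ∈ Ioo l' r', Real.sin (θ x) ≠ 0 := by
  by_contra! hs
  have hmid : (l' + r') / 2 ∈ Ioo l' r' := ⟨by linarith, by linarith⟩
  have h1 := hasDerivAt_eq_zero_of_eqOn_Ioo hs hmid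
    (hθ.hasDerivAt _ (Icc_subset_Icc hl hr (Ioo_subset_Icc_self hmid))).sin
  rw [prueferField_eq, hs _ hmid] at h1
  have h2 := Real.sin_sq_add_cos_sq (θ ((l' + r') / 2))
  rw [hs _ hmid] at h2
  rcases mul_eq_zero.1 h1 with h | h
  · rw [h] at h2
    norm_num at h2
  · simp [(hpos _).ne'] at h

/-- The difference of the angles is driven by `(ν - μ) p sin² θ ≥ 0`. Equality at the end would
force this source, hence `sin θ`, to vanish throughout. -/
lemma lt_of_lt (hlr : l < r) (hp : Continuous p) (hpos : ∀ x, 0 < p x) {ν : ℝ} {φ : ℝ → ℝ}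
    (hθ : IsPrueferAngle p μ l r θ) (hφ : IsPrueferAngle p ν l r φ) (hμν : μ < ν) :
    θ r < φ r := by
  have hne : ∀ t, p t ≠ 0 := fun t => (hpos t).ne'
  have hcont := hθ.continuousOn
  have hcont' := hφ.continuousOn
  obtain ⟨E, hE, hED⟩ := exists_integrating_factor_mul hlr.le (D := fun x => φ x - θ x)
    (g := fun x => (ν * p x - 1 / p x) * Real.sinc (φ x - θ x) * Real.sin (φ x + θ x))
    (h := fun x => (ν - μ) * p x * Real.sin (θ x) ^ 2) (by
      have := Real.continuous_sinc
      fun_prop (disch := simp [hne])) (fun x hx => by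
      refine ((hφ.hasDerivAt x hx).sub (hθ.hasDerivAt x hx)).congr_deriv ?_
      exact prueferField_sub p μ ν x (θ x) (φ x))
  have hnn : ∀ x ∈ Ioo l r, 0 ≤ E x * ((ν - μ) * p x * Real.sin (θ x) ^ 2) := fun x _ =>
    mul_nonneg (hE x).le (mul_nonneg (mul_nonneg (by linarith) (hpos x).le) (sq_nonneg _))
  have hm := monotoneOn_Icc_of_hasDerivAt hED hnn (left_mem_Icc.2 hlr.le)
    (right_mem_Icc.2 hlr.le) hlr.le
  simp only [hθ.init, hφ.init, sub_self, mul_zero] at hm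
  have hle : θ r ≤ φ r := by
    have := nonneg_of_mul_nonneg_right hm (hE r)
    linarith
  refine hle.lt_of_ne fun heq => ?_
  have h0 := deriv_eq_zero_of_nonneg_of_ends_eq hED hnn (by
    simp [hθ.init, hφ.init, heq])
  obtain ⟨x, hx, hs⟩ := hθ.exists_sin_ne_zero hpos le_rfl hlr le_rfl
  have h1 : ν - μ ≠ 0 := by linarith
  exact hs (by simpa [(hE x).ne', hne, h1] using h0 x hx)

end IsPrueferAngle

/-! ### The end angle as a function of the spectral parameter. -/

lemma tendsto_integral_one_div_one_add_mul_sin_sq (B : ℝ) :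
    Tendsto (fun n : ℕ => ∫ t in (0 : ℝ)..B, 1 / (1 + n * Real.sin t ^ 2)) atTop (𝓝 0) := by
  have hpos : ∀ (n : ℕ) (t : ℝ), 0 < 1 + n * Real.sin t ^ 2 := fun n t => by positivity
  have h : Tendsto (fun n : ℕ => ∫ t in (0 : ℝ)..B, 1 / (1 + n * Real.sin t ^ 2)) atTop
      (𝓝 (∫ t in (0 : ℝ)..B, (0 : ℝ))) := by
    refine intervalIntegral.tendsto_integral_filter_of_dominated_convergence (fun _ => 1)
      (Eventually.of_forall fun n => ?_) (Eventually.of_forall fun n => ?_)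
      intervalIntegrable_const ?_
    · refine Continuous.aestronglyMeasurable ?_
      fun_prop (disch := exact fun t => (hpos n t).ne')
    · refine Eventually.of_forall fun t _ => ?_
      rw [Real.norm_eq_abs, abs_of_pos (one_div_pos.2 (hpos n t)), div_le_one (hpos n t)]
      have : 0 ≤ n * Real.sin t ^ 2 := by positivity
      linarith
    · have hc : {t : ℝ | Real.sin t = 0}.Countable := by
        refine (countable_range fun n : ℤ => (n : ℝ) * Real.pi).mono fun t ht => ?_
        exact Real.sin_eq_zero_iff.1 ht
      filter_upwards [hc.ae_notMem MeasureTheory.volume] with t ht _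
      have hs : 0 < Real.sin t ^ 2 := by
        have : Real.sin t ≠ 0 := ht
        positivity
      refine Tendsto.div_atTop tendsto_const_nhds ?_
      exact tendsto_atTop_add_const_left _ _
        (tendsto_natCast_atTop_atTop.atTop_mul_const hs)
  simpa using h

namespace IsPrueferAngle

variable {p : ℝ → ℝ} {l r : ℝ} {Θ : ℝ → ℝ → ℝ}

lemma continuous_end (hlr : l ≤ r) (hp : Continuous p) (hpos : ∀ x, 0 < p x)
    (hΘ : ∀ μ, IsPrueferAngle p μ l r (Θ μ)) : Continuous fun μ => Θ μ r := by
  obtain ⟨m, hm, M, hM, hb⟩ := exists_bounds_on_Icc hlr hp hpos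
  refine continuous_iff_continuousAt.2 fun μ => ?_
  have key : ∀ ν, ‖Θ ν r - Θ μ r‖ ≤
      gronwallBound 0 (|μ| * M + 1 / m) (|ν - μ| * M) (r - l) := by
    intro ν
    refine norm_le_gronwallBound_of_norm_deriv_right_le (f := fun x => Θ ν x - Θ μ x)
      ((hΘ ν).continuousOn.sub (hΘ μ).continuousOn)
      (fun x hx => (((hΘ ν).hasDerivAt x (Ico_subset_Icc_self hx)).sub
        ((hΘ μ).hasDerivAt x (Ico_subset_Icc_self hx))).hasDerivWithinAt)
      (by simp [(hΘ _).init]) (fun x hx => ?_) r (right_mem_Icc.2 hlr)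
    have hx := hb x (Ico_subset_Icc_self hx)
    have h1 := prueferField_abs_sub_le (μ := μ) hm hx.1 hx.2 (Θ μ x) (Θ ν x)
    have h2 : prueferField p ν x (Θ ν x) - prueferField p μ x (Θ μ x) =
        (prueferField p μ x (Θ ν x) - prueferField p μ x (Θ μ x)) +
          (ν - μ) * p x * Real.sin (Θ ν x) ^ 2 := by
      simp only [prueferField]
      ring
    rw [h2]
    refine (norm_add_le _ _).trans (add_le_add h1 ?_)
    have h3 := Real.sin_sq_le_one (Θ ν x)
    rw [Real.norm_eq_abs, abs_mul, abs_mul, abs_of_pos (hpos x), abs_of_nonneg (sq_nonneg (Real.sin _))]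
    calc |ν - μ| * p x * Real.sin (Θ ν x) ^ 2 ≤ |ν - μ| * M * 1 := by gcongr; exact hx.2
      _ = _ := mul_one _
  refine tendsto_iff_norm_sub_tendsto_zero.2 (squeeze_zero (fun _ => norm_nonneg _) key ?_)
  have hc : Continuous fun ν : ℝ =>
      gronwallBound 0 (|μ| * M + 1 / m) (|ν - μ| * M) (r - l) :=
    (gronwallBound_continuous_ε 0 _ _).comp (by fun_prop)
  have := hc.tendsto μ
  simpa [gronwallBound_ε0_δ0] using this

/-- For `μ = 1 + n` one has `θ' ≥ c (1 + n sin² θ)`, so the integral of `1 / (1 + n sin² t)` from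
`0` to `θ r` is at least `c (r - l)`. If `θ r ≤ B` for all `n`, this contradicts the integral up to
`B` tending to `0`. -/
lemma exists_end_gt (hlr : l < r) (hp : Continuous p) (hpos : ∀ x, 0 < p x)
    (hΘ : ∀ μ, IsPrueferAngle p μ l r (Θ μ)) (B : ℝ) : ∃ μ, B < Θ μ r := by
  by_contra! hB
  obtain ⟨m, hm, M, hM, hb⟩ := exists_bounds_on_Icc hlr.le hp hpos
  set c := min m (1 / M) with hc
  have hcpos : 0 < c := lt_min hm (one_div_pos.2 hM)
  have hB0 : 0 ≤ B := ((hΘ 0).pos hp hpos ⟨hlr, le_rfl⟩).le.trans (hB 0)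
  have key : ∀ n : ℕ, c * (r - l) ≤ ∫ t in (0 : ℝ)..B, 1 / (1 + n * Real.sin t ^ 2) := by
    intro n
    have hw : ∀ t : ℝ, 0 < 1 + n * Real.sin t ^ 2 := fun t => by positivity
    have hcont : Continuous fun t : ℝ => 1 / (1 + n * Real.sin t ^ 2) := by
      fun_prop (disch := exact fun t => (hw t).ne')
    have hθ := hΘ (1 + n)
    have hmono := monotoneOn_Icc_of_hasDerivAt
      (f := fun x => (∫ t in (0 : ℝ)..Θ (1 + n) x, 1 / (1 + n * Real.sin t ^ 2)) - c * x)
      (fun x hx => (((hcont.integral_hasStrictDerivAt 0 _).hasDerivAt.comp x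
        (hθ.hasDerivAt x hx)).sub ((hasDerivAt_id x).const_mul c)))
      (fun x hx => by
        have hx := hb x (Ioo_subset_Icc_self hx)
        have h1 : c ≤ 1 / p x := (min_le_right _ _).trans
          (one_div_le_one_div_of_le (hpos x) hx.2)
        have h2 : c ≤ p x := (min_le_left _ _).trans hx.1
        have hs := Real.sin_sq_add_cos_sq (Θ (1 + n) x)
        rw [mul_one, sub_nonneg, div_mul_eq_mul_div, one_mul, le_div_iff₀ (hw _), prueferField]
        calc c * (1 + n * Real.sin (Θ (1 + n) x) ^ 2)
            = c * Real.cos (Θ (1 + n) x) ^ 2 + (1 + n) * c * Real.sin (Θ (1 + n) x) ^ 2 := by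
              linear_combination -c * hs
          _ ≤ (1 / p x) * Real.cos (Θ (1 + n) x) ^ 2
              + (1 + n) * p x * Real.sin (Θ (1 + n) x) ^ 2 := by gcongr
          _ = _ := by ring)
      (left_mem_Icc.2 hlr.le) (right_mem_Icc.2 hlr.le) hlr.le
    simp only [hθ.init, intervalIntegral.integral_same] at hmono
    have h2 : (∫ t in (0 : ℝ)..Θ (1 + n) r, 1 / (1 + n * Real.sin t ^ 2)) ≤
        ∫ t in (0 : ℝ)..B, 1 / (1 + n * Real.sin t ^ 2) :=
      intervalIntegral.integral_mono_interval le_rfl (hθ.pos hp hpos ⟨hlr, le_rfl⟩).le (hB _)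
        (Eventually.of_forall fun t => (one_div_pos.2 (hw t)).le) (hcont.intervalIntegrable _ _)
    linarith
  have := ge_of_tendsto' (tendsto_integral_one_div_one_add_mul_sin_sq B) key
  have : 0 < c * (r - l) := mul_pos hcpos (by linarith)
  linarith

/-- The values of the parameter for which the Prüfer angle at the right end is a multiple of `π`. -/
lemma exists_seq (hlr : l < r) (hp : Continuous p) (hpos : ∀ x, 0 < p x)
    (hΘ : ∀ μ, IsPrueferAngle p μ l r (Θ μ)) :
    ∃ m : ℕ+ → ℝ, StrictMono m ∧ (∀ k, 0 < m k ∧ Θ (m k) r = k * Real.pi) ∧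
      ∀ μ, 0 < μ → Real.sin (Θ μ r) = 0 → ∃ k, m k = μ := by
  have hmono : StrictMono fun μ => Θ μ r := fun μ ν h => (hΘ μ).lt_of_lt hlr hp hpos (hΘ ν) h
  have hcont := continuous_end hlr.le hp hpos hΘ
  have h0 := (hΘ 0).lt_pi_of_zero hlr.le hp hpos
  have hex : ∀ k : ℕ+, ∃ μ, 0 < μ ∧ Θ μ r = k * Real.pi := by
    intro k
    have hk : (1 : ℝ) ≤ k := Nat.one_le_cast.2 k.pos
    have hk' : Real.pi ≤ k * Real.pi := le_mul_of_one_le_left Real.pi_pos.le hk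
    obtain ⟨ν, hν⟩ := exists_end_gt hlr hp hpos hΘ (k * Real.pi)
    have hν0 : 0 < ν := hmono.lt_iff_lt.1 (h0.trans (hk'.trans_lt hν))
    obtain ⟨μ, hμ, hμ'⟩ := intermediate_value_Ioo hν0.le hcont.continuousOn
      (⟨h0.trans_le hk', hν⟩ : (k * Real.pi : ℝ) ∈ Ioo (Θ 0 r) (Θ ν r))
    exact ⟨μ, hμ.1, hμ'⟩
  choose m hm using hex
  refine ⟨m, fun j k hjk => ?_, hm, fun μ hμ hs => ?_⟩
  · refine hmono.lt_iff_lt.1 ?_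
    simp only [(hm _).2]
    have : (j : ℝ) < k := by exact_mod_cast hjk
    exact mul_lt_mul_of_pos_right this Real.pi_pos
  · obtain ⟨n, hn⟩ := Real.sin_eq_zero_iff.1 hs
    have hpos' : 0 < (n : ℝ) := by
      have := (hΘ μ).pos hp hpos ⟨hlr, le_rfl⟩
      rw [← hn] at this
      exact pos_of_mul_pos_left this Real.pi_pos.le
    lift n to ℕ using by exact_mod_cast hpos'.le
    refine ⟨Nat.toPNat n (by exact_mod_cast hpos'), hmono.injective ?_⟩
    rw [(hm _).2, ← hn]
    rfl

end IsPrueferAngle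

/-! ### The Sturm–Liouville system. -/

/-- `(v, q)` solves the Sturm–Liouville system `v' = q / p`, `q' = -m p v` on `[l, r]`, that is,
`(p v')' + m p v = 0` with flux `q = p v'`. -/
structure IsSturmLiouvilleSolution {𝕜 : Type*} [RCLike 𝕜] (p : ℝ → ℝ) (m : 𝕜) (l r : ℝ)
    (v q : ℝ → 𝕜) : Prop where
  hasDerivAt_fst : ∀ x ∈ Icc l r, HasDerivAt v ((p x)⁻¹ • q x) x
  hasDerivAt_snd : ∀ x ∈ Icc l r, HasDerivAt q (-(p x • (m * v x))) x

/-- The solution of the Sturm–Liouville system with a given Prüfer angle. -/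
lemma IsPrueferAngle.exists_solution {p : ℝ → ℝ} {l r μ : ℝ} {θ : ℝ → ℝ}
    (hθ : IsPrueferAngle p μ l r θ) (hlr : l ≤ r) (hp : Continuous p) (hpos : ∀ x, 0 < p x) :
    ∃ ρ : ℝ → ℝ, ρ l = 1 ∧ (∀ x, 0 < ρ x) ∧
      IsSturmLiouvilleSolution p μ l r (fun x => ρ x * Real.sin (θ x))
        (fun x => ρ x * Real.cos (θ x)) := by
  have hne : ∀ t, p t ≠ 0 := fun t => (hpos t).ne'
  have hcont := hθ.continuousOn
  obtain ⟨ρ, h1, hρ, hd⟩ := exists_integrating_factor hlr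
    (g := fun x => (1 / p x - μ * p x) * Real.sin (θ x) * Real.cos (θ x))
    (by fun_prop (disch := simp [hne]))
  refine ⟨ρ, h1, hρ, fun x hx => ?_, fun x hx => ?_⟩
  · refine ((hd x hx).mul (hθ.hasDerivAt x hx).sin).congr_deriv ?_
    have hs := Real.sin_sq_add_cos_sq (θ x)
    rw [prueferField, smul_eq_mul]
    linear_combination (ρ x * Real.cos (θ x) * (p x)⁻¹) * hs
  · refine ((hd x hx).mul (hθ.hasDerivAt x hx).cos).congr_deriv ?_
    have hs := Real.sin_sq_add_cos_sq (θ x)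
    rw [prueferField, smul_eq_mul]
    linear_combination (-ρ x * Real.sin (θ x) * p x * μ) * hs

namespace IsSturmLiouvilleSolution

section RCLike

variable {𝕜 : Type*} [RCLike 𝕜] {p : ℝ → ℝ} {m : 𝕜} {l r : ℝ} {v q : ℝ → 𝕜}

lemma mono (h : IsSturmLiouvilleSolution p m l r v q) {l' r' : ℝ} (hl : l ≤ l') (hr : r' ≤ r) :
    IsSturmLiouvilleSolution p m l' r' v q :=
  ⟨fun x hx => h.hasDerivAt_fst x (Icc_subset_Icc hl hr hx),
    fun x hx => h.hasDerivAt_snd x (Icc_subset_Icc hl hr hx)⟩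

lemma sub_const_mul (h : IsSturmLiouvilleSolution p m l r v q) {w s : ℝ → 𝕜}
    (h' : IsSturmLiouvilleSolution p m l r w s) (c : 𝕜) :
    IsSturmLiouvilleSolution p m l r (fun x => v x - c * w x) (fun x => q x - c * s x) := by
  refine ⟨fun x hx => ((h.hasDerivAt_fst x hx).sub
    ((h'.hasDerivAt_fst x hx).const_mul c)).congr_deriv ?_, fun x hx =>
    ((h.hasDerivAt_snd x hx).sub ((h'.hasDerivAt_snd x hx).const_mul c)).congr_deriv ?_⟩
  · simp only [RCLike.real_smul_eq_coe_mul]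
    ring
  · simp only [RCLike.real_smul_eq_coe_mul]
    ring

lemma eq_zero (h : IsSturmLiouvilleSolution p m l r v q) (hlr : l ≤ r) (hp : Continuous p)
    (hpos : ∀ x, 0 < p x) (hv : v l = 0) (hq : q l = 0) :
    ∀ x ∈ Icc l r, v x = 0 ∧ q x = 0 := by
  obtain ⟨c, hc, M, hM, hb⟩ := exists_bounds_on_Icc hlr hp hpos
  have hd : ∀ x ∈ Icc l r, HasDerivAt (fun x => (v x, q x))
      ((p x)⁻¹ • q x, -(p x • (m * v x))) x := fun x hx =>
    (h.hasDerivAt_fst x hx).prodMk (h.hasDerivAt_snd x hx)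
  intro x hx
  have := eq_zero_of_abs_deriv_le_mul_abs_self_of_eq_zero_right (K := c⁻¹ + M * ‖m‖)
    (fun x hx => (hd x hx).continuousAt.continuousWithinAt)
    (fun x hx => (hd x (Ico_subset_Icc_self hx)).hasDerivWithinAt) (by simp [hv, hq])
    (fun x hx => by
      have hx := hb x (Ico_subset_Icc_self hx)
      have hv' : ‖v x‖ ≤ ‖(v x, q x)‖ := norm_fst_le (v x, q x)
      have hq' : ‖q x‖ ≤ ‖(v x, q x)‖ := norm_snd_le (v x, q x)
      set N := ‖(v x, q x)‖
      have hN : 0 ≤ N := norm_nonneg _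
      have h1 : (p x)⁻¹ ≤ c⁻¹ := inv_anti₀ hc hx.1
      refine norm_prod_le_iff.2 ⟨?_, ?_⟩
      · rw [norm_smul, norm_inv, Real.norm_eq_abs, abs_of_pos (hpos x)]
        calc (p x)⁻¹ * ‖q x‖ ≤ c⁻¹ * N := by gcongr
          _ ≤ (c⁻¹ + M * ‖m‖) * N := by
            gcongr
            exact le_add_of_nonneg_right (by positivity)
      · rw [norm_neg, norm_smul, norm_mul, Real.norm_eq_abs, abs_of_pos (hpos x)]
        calc p x * (‖m‖ * ‖v x‖) ≤ M * (‖m‖ * N) := by gcongr; exact hx.2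
          _ = (M * ‖m‖) * N := by ring
          _ ≤ (c⁻¹ + M * ‖m‖) * N := by
            gcongr
            exact le_add_of_nonneg_left (by positivity)) x hx
  exact ⟨congrArg Prod.fst this, congrArg Prod.snd this⟩

/-- Solutions vanishing at the left end are proportional. -/
lemma eq_const_mul (h : IsSturmLiouvilleSolution p m l r v q) (hlr : l ≤ r) (hp : Continuous p)
    (hpos : ∀ x, 0 < p x) (hv : v l = 0) {w s : ℝ → 𝕜}
    (h' : IsSturmLiouvilleSolution p m l r w s) (hw : w l = 0) (hs : s l = 1) :
    ∀ x ∈ Icc l r, v x = q l * w x := by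
  intro x hx
  have := ((h.sub_const_mul h' (q l)).eq_zero hlr hp hpos (by simp [hv, hw]) (by simp [hs]) x hx).1
  exact sub_eq_zero.1 this

end RCLike

lemma ofReal {p : ℝ → ℝ} {μ l r : ℝ} {y Y : ℝ → ℝ}
    (h : IsSturmLiouvilleSolution p μ l r y Y) :
    IsSturmLiouvilleSolution p (μ : ℂ) l r (fun x => (y x : ℂ)) (fun x => (Y x : ℂ)) := by
  refine ⟨fun x hx => (h.hasDerivAt_fst x hx).ofReal_comp.congr_deriv ?_,
    fun x hx => (h.hasDerivAt_snd x hx).ofReal_comp.congr_deriv ?_⟩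
  · simp
  · simp

/-- Dirichlet eigenvalues of a Sturm–Liouville problem are real and positive. -/
lemma exists_pos_of_ends_eq_zero {p : ℝ → ℝ} {m : ℂ} {l r : ℝ} {v q : ℝ → ℂ}
    (h : IsSturmLiouvilleSolution p m l r v q) (hpos : ∀ x, 0 < p x)
    (hl : v l = 0) (hr : v r = 0) (hne : ∃ x ∈ Ioo l r, v x ≠ 0) :
    ∃ μ : ℝ, 0 < μ ∧ m = μ := by
  obtain ⟨x₀, hx₀, hvx₀⟩ := hne
  have hre : ∀ {f : ℝ → ℂ} {f' : ℂ} {x : ℝ}, HasDerivAt f f' x →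
      HasDerivAt (fun x => (f x).re) f'.re x := fun hf =>
    (Complex.reCLM.hasFDerivAt.comp_hasDerivAt _ hf)
  have him : ∀ {f : ℝ → ℂ} {f' : ℂ} {x : ℝ}, HasDerivAt f f' x →
      HasDerivAt (fun x => (f x).im) f'.im x := fun hf =>
    (Complex.imCLM.hasFDerivAt.comp_hasDerivAt _ hf)
  have hvr := fun x hx => hre (h.hasDerivAt_fst x hx)
  have hvi := fun x hx => him (h.hasDerivAt_fst x hx)
  have hqr := fun x hx => hre (h.hasDerivAt_snd x hx)
  have hqi := fun x hx => him (h.hasDerivAt_snd x hx)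
  simp only [Complex.real_smul, Complex.mul_re, Complex.mul_im, Complex.neg_re, Complex.neg_im,
    Complex.ofReal_re, Complex.ofReal_im, zero_mul, sub_zero,
    add_zero] at hvr hvi hqr hqi
  have hnormSq : 0 < (v x₀).re ^ 2 + (v x₀).im ^ 2 := by
    have := Complex.normSq_pos.2 hvx₀
    rw [Complex.normSq_apply] at this
    linarith
  have him0 : m.im = 0 := by
    by_contra hm
    -- Lagrange identity: `Im (v̄ q)` vanishes at both ends and has derivative `-Im m · p |v|²`.
    have hd : ∀ x ∈ Icc l r, HasDerivAt
        (fun x => -((v x).re * (q x).im - (v x).im * (q x).re) / m.im)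
        (p x * ((v x).re ^ 2 + (v x).im ^ 2)) x := fun x hx => by
      refine ((((hvr x hx).mul (hqi x hx)).sub ((hvi x hx).mul (hqr x hx))).neg.div_const
        m.im).congr_deriv ?_
      have := (hpos x).ne'
      field_simp
      ring
    have := deriv_eq_zero_of_nonneg_of_ends_eq hd
      (fun x _ => mul_nonneg (hpos x).le (by positivity)) (by simp [hl, hr]) x₀ hx₀
    exact (mul_pos (hpos x₀) hnormSq).ne' this
  have hre0 : 0 < m.re := by
    by_contra! hm
    -- Energy identity for `Re (v̄ q)`: if `Re m ≤ 0` both terms are nonnegative, so `q = 0` inside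
    -- and `v` is constant, hence zero.
    have hd : ∀ x ∈ Icc l r, HasDerivAt
        (fun x => (v x).re * (q x).re + (v x).im * (q x).im)
        ((p x)⁻¹ * ((q x).re ^ 2 + (q x).im ^ 2) +
          (-m.re) * (p x * ((v x).re ^ 2 + (v x).im ^ 2))) x := fun x hx => by
      refine (((hvr x hx).mul (hqr x hx)).add ((hvi x hx).mul (hqi x hx))).congr_deriv ?_
      rw [him0]
      ring
    have hA : ∀ x, 0 ≤ (p x)⁻¹ * ((q x).re ^ 2 + (q x).im ^ 2) := fun x =>
      mul_nonneg (inv_pos.2 (hpos x)).le (by positivity)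
    have hB : ∀ x, 0 ≤ (-m.re) * (p x * ((v x).re ^ 2 + (v x).im ^ 2)) := fun x =>
      mul_nonneg (by linarith) (mul_nonneg (hpos x).le (by positivity))
    have h0 := deriv_eq_zero_of_nonneg_of_ends_eq hd (fun x _ => add_nonneg (hA x) (hB x))
      (by simp [hl, hr])
    have hq0 : ∀ x ∈ Ioo l r, (q x).re = 0 ∧ (q x).im = 0 := fun x hx => by
      have h1 : (p x)⁻¹ * ((q x).re ^ 2 + (q x).im ^ 2) = 0 := by
        linarith [h0 x hx, hA x, hB x]
      rcases mul_eq_zero.1 h1 with h2 | h2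
      · exact absurd h2 (inv_pos.2 (hpos x)).ne'
      · constructor <;> nlinarith [sq_nonneg (q x).re, sq_nonneg (q x).im]
    have hx₀' := Ioo_subset_Icc_self hx₀
    have hmr := monotoneOn_Icc_of_hasDerivAt hvr (fun x hx => by simp [(hq0 x hx).1])
    have hmi := monotoneOn_Icc_of_hasDerivAt hvi (fun x hx => by simp [(hq0 x hx).2])
    have hll := left_mem_Icc.2 (hx₀.1.trans hx₀.2).le
    have hrr := right_mem_Icc.2 (hx₀.1.trans hx₀.2).le
    have h1 := hmr hll hx₀' hx₀.1.le
    have h2 := hmr hx₀' hrr hx₀.2.le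
    have h3 := hmi hll hx₀' hx₀.1.le
    have h4 := hmi hx₀' hrr hx₀.2.le
    simp only [hl, hr, Complex.zero_re, Complex.zero_im] at h1 h2 h3 h4
    exact hvx₀ (Complex.ext (le_antisymm h2 h1) (le_antisymm h4 h3))
  exact ⟨m.re, hre0, Complex.ext rfl him0⟩

/-! ### Riccati bounds for Dirichlet eigenvalues. -/

section Real

variable {p : ℝ → ℝ} {μ l r : ℝ} {y Y : ℝ → ℝ}

/-- A lower bound for Dirichlet eigenvalues, from a solution of a Riccati inequality. -/
lemma le_of_riccati (h : IsSturmLiouvilleSolution p μ l r y Y) (hpos : ∀ x, 0 < p x)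
    (hl : y l = 0) (hr : y r = 0) (hne : ∃ x ∈ Ioo l r, y x ≠ 0) {κ : ℝ} {S S' : ℝ → ℝ}
    (hS : ∀ x ∈ Icc l r, HasDerivAt S (S' x) x)
    (hric : ∀ x ∈ Ioo l r, S' x + S x ^ 2 / p x + κ * p x ≤ 0) : κ ≤ μ := by
  obtain ⟨x₀, hx₀, hyx₀⟩ := hne
  by_contra! hlt
  -- Picone identity: completing the square leaves only nonnegative terms when `μ < κ`, while `y Y -
  -- S y²` vanishes at both ends.
  have hd : ∀ x ∈ Icc l r, HasDerivAt (fun x => y x * Y x - S x * y x ^ 2)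
      ((Y x - S x * y x) ^ 2 / p x + (κ - μ) * (p x * y x ^ 2)
        + -(S' x + S x ^ 2 / p x + κ * p x) * y x ^ 2) x := fun x hx => by
    refine (((h.hasDerivAt_fst x hx).mul (h.hasDerivAt_snd x hx)).sub ((hS x hx).mul
      ((h.hasDerivAt_fst x hx).pow 2))).congr_deriv ?_
    simp only [smul_eq_mul, Pi.pow_apply]
    have := (hpos x).ne'
    field_simp
    ring
  have hA : ∀ x, 0 ≤ (Y x - S x * y x) ^ 2 / p x := fun x => div_nonneg (sq_nonneg _) (hpos x).le
  have hB : ∀ x, 0 ≤ (κ - μ) * (p x * y x ^ 2) := fun x =>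
    mul_nonneg (by linarith) (mul_nonneg (hpos x).le (sq_nonneg _))
  have hC : ∀ x ∈ Ioo l r, 0 ≤ -(S' x + S x ^ 2 / p x + κ * p x) * y x ^ 2 := fun x hx =>
    mul_nonneg (by linarith [hric x hx]) (sq_nonneg _)
  have h0 := deriv_eq_zero_of_nonneg_of_ends_eq hd
    (fun x hx => add_nonneg (add_nonneg (hA x) (hB x)) (hC x hx)) (by simp [hl, hr]) x₀ hx₀
  have h1 : (κ - μ) * (p x₀ * y x₀ ^ 2) = 0 := by linarith [hA x₀, hB x₀, hC x₀ hx₀]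
  have h2 : 0 < (κ - μ) * (p x₀ * y x₀ ^ 2) :=
    mul_pos (by linarith) (mul_pos (hpos x₀) (by positivity))
  exact h2.ne' h1

/-- An upper bound for the first Dirichlet eigenvalue, through the logarithmic derivative of a
positive eigenfunction. -/
lemma mul_le_of_pos (h : IsSturmLiouvilleSolution p μ l r y Y) (hpos : ∀ x, 0 < p x)
    (hμ : 0 ≤ μ) (hl : y l = 0) (hr : y r = 0) (hy : ∀ x ∈ Ioo l r, 0 < y x)
    {β s t γ c P Q : ℝ} (hβ : l < β) (hβs : β ≤ s) (hst : s ≤ t) (htγ : t ≤ γ) (hγ : γ < r)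
    (hc : ∀ x ∈ Icc s t, c ≤ p x) (hP : ∀ x ∈ Icc l β, p x ≤ P) (hQ : ∀ x ∈ Icc γ r, p x ≤ Q) :
    μ * c * (t - s) ≤ P / (β - l) + Q / (r - γ) := by
  have hβγ : β ≤ γ := hβs.trans (hst.trans htγ)
  have hYm : AntitoneOn Y (Icc l r) := by
    have := monotoneOn_Icc_of_hasDerivAt (fun x hx => (h.hasDerivAt_snd x hx).neg) (fun x hx => by
      rw [neg_neg, smul_eq_mul]
      have := hpos x
      have := hy x hx
      positivity)
    exact fun a ha b hb hab => neg_le_neg_iff.1 (this ha hb hab)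
  have hβm : β ∈ Ioo l r := ⟨hβ, hβγ.trans_lt hγ⟩
  have hγm : γ ∈ Ioo l r := ⟨hβ.trans_le hβγ, hγ⟩
  have hP0 : 0 < P := (hpos β).trans_le (hP β ⟨hβ.le, le_rfl⟩)
  have hQ0 : 0 < Q := (hpos γ).trans_le (hQ γ ⟨le_rfl, hγ.le⟩)
  -- The flux `Y` decreases, so `y' = Y / p ≥ Y β / P` on `[l, β]` when `Y β > 0`; integrate from `y
  -- l = 0`. The other end is symmetric.
  have h1 : Y β / y β ≤ P / (β - l) := by
    rw [div_le_div_iff₀ (hy β hβm) (by linarith)]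
    rcases le_or_gt (Y β) 0 with hneg | hYβ
    · exact (mul_nonpos_of_nonpos_of_nonneg hneg (by linarith)).trans
        (mul_pos hP0 (hy β hβm)).le
    · have := monotoneOn_Icc_of_hasDerivAt (l := l) (r := β) (f := fun x => P * y x - Y β * x)
        (fun x hx => ((h.hasDerivAt_fst x ⟨hx.1, hx.2.trans hβm.2.le⟩).const_mul P).sub
          ((hasDerivAt_id x).const_mul (Y β))) (fun x hx => by
          have hY := hYm ⟨hx.1.le, (hx.2.trans hβm.2).le⟩ (Ioo_subset_Icc_self hβm) hx.2.le
          have h2 : 1 ≤ P * (p x)⁻¹ := by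
            rw [← div_eq_mul_inv, one_le_div (hpos x)]
            exact hP x (Ioo_subset_Icc_self hx)
          rw [smul_eq_mul]
          nlinarith) (left_mem_Icc.2 hβ.le) (right_mem_Icc.2 hβ.le) hβ.le
      simp only [hl] at this
      linarith
  have h2 : -(Y γ / y γ) ≤ Q / (r - γ) := by
    rw [← neg_div, div_le_div_iff₀ (hy γ hγm) (by linarith)]
    rcases le_or_gt 0 (Y γ) with hneg | hYγ
    · exact (mul_nonpos_of_nonpos_of_nonneg (by linarith) (by linarith)).trans
        (mul_pos hQ0 (hy γ hγm)).le
    · have := monotoneOn_Icc_of_hasDerivAt (l := γ) (r := r) (f := fun x => Y γ * x - Q * y x)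
        (fun x hx => ((hasDerivAt_id x).const_mul (Y γ)).sub
          ((h.hasDerivAt_fst x ⟨hγm.1.le.trans hx.1, hx.2⟩).const_mul Q)) (fun x hx => by
          have hY := hYm (Ioo_subset_Icc_self hγm) ⟨(hγm.1.trans hx.1).le, hx.2.le⟩ hx.1.le
          have h2 : 1 ≤ Q * (p x)⁻¹ := by
            rw [← div_eq_mul_inv, one_le_div (hpos x)]
            exact hQ x (Ioo_subset_Icc_self hx)
          rw [smul_eq_mul]
          nlinarith) (left_mem_Icc.2 hγ.le) (right_mem_Icc.2 hγ.le) hγ.le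
      simp only [hr] at this
      linarith
  -- Discarding the square, `-Y / y` increases by at least `μ c (t - s)` between `β` and `γ`, where
  -- its end values are already controlled.
  have hR : ∀ x ∈ Icc β γ, HasDerivAt (fun x => -(Y x / y x))
      (μ * p x + (Y x / y x) ^ 2 / p x) x := fun x hx => by
    have hx' : x ∈ Ioo l r := ⟨hβ.trans_le hx.1, hx.2.trans_lt hγ⟩
    have hx'' := Ioo_subset_Icc_self hx'
    have hy0 := (hy x hx').ne'
    refine ((h.hasDerivAt_snd x hx'').div (h.hasDerivAt_fst x hx'') hy0).neg.congr_deriv ?_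
    have := (hpos x).ne'
    simp only [smul_eq_mul]
    field_simp
    ring
  have hsq : ∀ x, 0 ≤ (Y x / y x) ^ 2 / p x := fun x => div_nonneg (sq_nonneg _) (hpos x).le
  have hRm := monotoneOn_Icc_of_hasDerivAt hR fun x _ =>
    add_nonneg (mul_nonneg hμ (hpos x).le) (hsq x)
  have h3 := hRm (left_mem_Icc.2 hβγ) ⟨hβs, hst.trans htγ⟩ hβs
  have h4 := hRm ⟨hβs.trans hst, htγ⟩ (right_mem_Icc.2 hβγ) htγ
  have h5 := monotoneOn_Icc_of_hasDerivAt (l := s) (r := t)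
    (f := fun x => -(Y x / y x) - μ * c * x)
    (fun x hx => (hR x ⟨hβs.trans hx.1, hx.2.trans htγ⟩).sub
      ((hasDerivAt_id x).const_mul (μ * c))) (fun x hx => by
      have := mul_le_mul_of_nonneg_left (hc x (Ioo_subset_Icc_self hx)) hμ
      linarith [hsq x]) (left_mem_Icc.2 hst) (right_mem_Icc.2 hst) hst
  simp only at h3 h4 h5
  linarith

end Real

end IsSturmLiouvilleSolution

/-! ### Reduction of the operator to Sturm–Liouville form. -/

/-- `u ↦ u / p` turns `ε u'' - (a u)' = z u` into a Sturm–Liouville problem when `p' = (a / ε) p`. -/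
lemma IsDirichletEigenfunction.exists_solution {ℓ ε : ℝ} {a p : ℝ → ℝ} {z : ℂ} {u : ℝ → ℂ}
    (hu : IsDirichletEigenfunction ℓ ε a z u) (hℓ : 0 < ℓ) (hε : 0 < ε) (hp : Continuous p)
    (hpos : ∀ x, 0 < p x) (hpd : ∀ x ∈ Ioo (-ℓ) ℓ, HasDerivAt p (a x / ε * p x) x) :
    ∃ v q : ℝ → ℂ, IsSturmLiouvilleSolution p (-z / ε) (-ℓ) ℓ v q ∧
      ∀ x ∈ Icc (-ℓ) ℓ, u x = p x * v x := by
  have hle : -ℓ ≤ ℓ := by linarith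
  have h0 : (0 : ℝ) ∈ Ioo (-ℓ) ℓ := ⟨by linarith, hℓ⟩
  have hεC : (ε : ℂ) ≠ 0 := by exact_mod_cast hε.ne'
  have hpC : ∀ x, (p x : ℂ) ≠ 0 := fun x => by exact_mod_cast (hpos x).ne'
  have hwc : ContinuousOn (fun x => u x / (p x : ℂ)) (Icc (-ℓ) ℓ) :=
    hu.continuousOn.div (by fun_prop) fun x _ => hpC x
  set w : ℝ → ℂ := IccExtend hle ((Icc (-ℓ) ℓ).domRestrict fun x => u x / (p x : ℂ)) with hw
  have hwcont : Continuous w := hwc.domRestrict.Icc_extend'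
  have hwu : ∀ x ∈ Icc (-ℓ) ℓ, w x = u x / p x := fun x hx => by
    rw [hw, IccExtend_of_mem hle _ hx, domRestrict_apply]
  have hwd : ∀ x ∈ Ioo (-ℓ) ℓ,
      HasDerivAt w ((p x)⁻¹ • (deriv u x - (a x / ε : ℝ) * u x)) x := by
    intro x hx
    have h1 := (hu.differentiableAt x hx).hasDerivAt.div (hpd x hx).ofReal_comp (hpC x)
    have h2 : w =ᶠ[𝓝 x] fun x => u x / (p x : ℂ) := by
      filter_upwards [Ioo_mem_nhds hx.1 hx.2] with y hy using hwu y (Ioo_subset_Icc_self hy)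
    refine (h1.congr_of_eventuallyEq h2).congr_deriv ?_
    rw [Complex.real_smul]
    have := hpC x
    push_cast
    field_simp
  have hqd : ∀ x ∈ Ioo (-ℓ) ℓ, HasDerivAt (fun x => deriv u x - (a x / ε : ℝ) * u x)
      (-(p x • (-z / ε * w x))) x := by
    intro x hx
    have h1 := (hu.equation x hx).div_const (ε : ℂ)
    refine (h1.congr_of_eventuallyEq (Eventually.of_forall fun y => ?_)).congr_deriv ?_
    · push_cast
      field_simp
    · rw [hwu x (Ioo_subset_Icc_self hx), Complex.real_smul]
      have := hpC x
      field_simp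
  have hQ : Continuous fun x => -(p x • (-z / ε * w x)) := by fun_prop
  -- The equation for `u` holds only in the open interval. Redefining flux and solution as
  -- antiderivatives of functions continuous on `ℝ` supplies derivatives at `±ℓ` as well; agreement
  -- at the ends follows by closure.
  set q : ℝ → ℂ := fun x => (deriv u 0 - (a 0 / ε : ℝ) * u 0) +
    ∫ t in (0 : ℝ)..x, -(p t • (-z / ε * w t)) with hq
  have hqd' : ∀ x, HasDerivAt q (-(p x • (-z / ε * w x))) x := fun x =>
    (hQ.integral_hasStrictDerivAt 0 x).hasDerivAt.const_add _
  have hqq : EqOn (fun x => deriv u x - (a x / ε : ℝ) * u x) q (Ioo (-ℓ) ℓ) :=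
    isOpen_Ioo.eqOn_of_deriv_eq isPreconnected_Ioo
      (fun x hx => (hqd x hx).differentiableAt.differentiableWithinAt)
      (fun x _ => (hqd' x).differentiableAt.differentiableWithinAt)
      (fun x hx => (hqd x hx).deriv.trans (hqd' x).deriv.symm) h0 (by simp [hq])
  have hqcont : Continuous q := continuous_iff_continuousAt.2 fun x => (hqd' x).continuousAt
  have hV : Continuous fun x => (p x)⁻¹ • q x := by
    fun_prop (disch := exact fun x => (hpos x).ne')
  set v : ℝ → ℂ := fun x => w 0 + ∫ t in (0 : ℝ)..x, (p t)⁻¹ • q t with hv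
  have hvd : ∀ x, HasDerivAt v ((p x)⁻¹ • q x) x := fun x =>
    (hV.integral_hasStrictDerivAt 0 x).hasDerivAt.const_add _
  have hwv : EqOn w v (Ioo (-ℓ) ℓ) :=
    isOpen_Ioo.eqOn_of_deriv_eq isPreconnected_Ioo
      (fun x hx => (hwd x hx).differentiableAt.differentiableWithinAt)
      (fun x _ => (hvd x).differentiableAt.differentiableWithinAt)
      (fun x hx => by
        rw [(hwd x hx).deriv, (hvd x).deriv]
        exact congrArg _ (hqq hx)) h0 (by simp [hv])
  have hwv' : EqOn w v (Icc (-ℓ) ℓ) := by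
    have := hwv.closure hwcont (continuous_iff_continuousAt.2 fun x => (hvd x).continuousAt)
    rwa [closure_Ioo (by linarith)] at this
  refine ⟨v, q, ⟨fun x _ => hvd x, fun x hx => ?_⟩, fun x hx => ?_⟩
  · rw [← hwv' hx]
    exact hqd' x
  · rw [← hwv' hx, hwu x hx, mul_div_cancel₀ _ (hpC x)]

lemma IsSturmLiouvilleSolution.isDirichletEigenfunction {ℓ ε μ : ℝ} {a p y Y : ℝ → ℝ}
    (h : IsSturmLiouvilleSolution p μ (-ℓ) ℓ y Y) (hε : 0 < ε)
    (hpos : ∀ x, 0 < p x) (hpc : Continuous p)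
    (hpd : ∀ x ∈ Ioo (-ℓ) ℓ, HasDerivAt p (a x / ε * p x) x)
    (hl : y (-ℓ) = 0) (hr : y ℓ = 0) (hne : ∃ x ∈ Icc (-ℓ) ℓ, y x ≠ 0) :
    IsDirichletEigenfunction ℓ ε a ((-(ε * μ) : ℝ) : ℂ) (fun x => ((p x * y x : ℝ) : ℂ)) := by
  have hd : ∀ x ∈ Ioo (-ℓ) ℓ, HasDerivAt (fun x => ((p x * y x : ℝ) : ℂ))
      ((a x / ε * (p x * y x) + Y x : ℝ) : ℂ) x := fun x hx => by
    refine HasDerivAt.ofReal_comp (((hpd x hx).mul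
      (h.hasDerivAt_fst x (Ioo_subset_Icc_self hx))).congr_deriv ?_)
    have := (hpos x).ne'
    rw [smul_eq_mul]
    field_simp
  refine ⟨fun x hx => ?_, by simp [hl], by simp [hr], ?_, fun x hx => (hd x hx).differentiableAt,
    fun x hx => ?_⟩
  · exact (Complex.continuous_ofReal.continuousAt.comp
      (hpc.continuousAt.mul (h.hasDerivAt_fst x hx).continuousAt)).continuousWithinAt
  · obtain ⟨x, hx, hy⟩ := hne
    exact ⟨x, hx, by exact_mod_cast mul_ne_zero (hpos x).ne' hy⟩
  · have h1 : HasDerivAt (fun x => ((ε * Y x : ℝ) : ℂ))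
        ((ε * -(p x * (μ * y x)) : ℝ) : ℂ) x :=
      HasDerivAt.ofReal_comp ((h.hasDerivAt_snd x (Ioo_subset_Icc_self hx)).const_mul ε)
    refine (h1.congr_of_eventuallyEq ?_).congr_deriv ?_
    · filter_upwards [Ioo_mem_nhds hx.1 hx.2] with t ht
      rw [(hd t ht).deriv]
      have : (ε : ℂ) ≠ 0 := by exact_mod_cast hε.ne'
      push_cast
      field_simp
      ring
    · push_cast
      ring

/-- The eigenvalues are `-ε μ`, where `μ` runs through the parameters for which the Prüfer angle at
the right end is a multiple of `π`. -/
theorem exists_isEigenvalueSequence {ℓ ε : ℝ} {a p : ℝ → ℝ} (hℓ : 0 < ℓ) (hε : 0 < ε)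
    (hp : Continuous p) (hpos : ∀ x, 0 < p x)
    (hpd : ∀ x ∈ Ioo (-ℓ) ℓ, HasDerivAt p (a x / ε * p x) x) :
    ∃ lam : ℕ+ → ℝ, IsEigenvalueSequence ℓ ε a lam ∧ ∀ k : ℕ+, ∃ μ θ, 0 < μ ∧
      lam k = -(ε * μ) ∧ IsPrueferAngle p μ (-ℓ) ℓ θ ∧ θ ℓ = k * Real.pi := by
  have hlt : -ℓ < ℓ := by linarith
  have hεC : (ε : ℂ) ≠ 0 := by exact_mod_cast hε.ne'
  choose Θ hΘ using IsPrueferAngle.exists_angle hlt.le hp hpos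
  obtain ⟨m, hmono, hm, hall⟩ := IsPrueferAngle.exists_seq hlt hp hpos hΘ
  have hsol := fun μ => (hΘ μ).exists_solution hlt.le hp hpos
  have hend : ∀ k, Real.sin (Θ (m k) ℓ) = 0 := fun k => by
    rw [(hm k).2]
    exact Real.sin_nat_mul_pi _
  refine ⟨fun k => -(ε * m k), ⟨fun j k hjk => ?_, ?_, ?_⟩, fun k =>
    ⟨m k, Θ (m k), (hm k).1, rfl, hΘ _, (hm k).2⟩⟩
  · exact neg_lt_neg (mul_lt_mul_of_pos_left (hmono hjk) hε)
  · refine Subset.antisymm ?_ ?_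
    · rintro _ ⟨k, rfl⟩
      obtain ⟨ρ, hρ1, hρ, hs⟩ := hsol (m k)
      refine ⟨_, hs.isDirichletEigenfunction hε hpos hp hpd (by simp [(hΘ _).init])
        (by simp [hend]) ?_⟩
      obtain ⟨x, hx, hsin⟩ := (hΘ (m k)).exists_sin_ne_zero hpos le_rfl hlt le_rfl
      exact ⟨x, Ioo_subset_Icc_self hx, mul_ne_zero (hρ x).ne' hsin⟩
    · rintro z ⟨u, hu⟩
      obtain ⟨v, q, hvq, huv⟩ := hu.exists_solution hℓ hε hp hpos hpd
      have hpC : ∀ x, (p x : ℂ) ≠ 0 := fun x => by exact_mod_cast (hpos x).ne'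
      have hvl : v (-ℓ) = 0 := by
        have := huv _ (left_mem_Icc.2 hlt.le)
        rw [hu.boundary_left] at this
        exact (mul_eq_zero.1 this.symm).resolve_left (hpC _)
      have hvr : v ℓ = 0 := by
        have := huv _ (right_mem_Icc.2 hlt.le)
        rw [hu.boundary_right] at this
        exact (mul_eq_zero.1 this.symm).resolve_left (hpC _)
      obtain ⟨x₀, hx₀, hux₀⟩ := hu.nonzero
      have hvx₀ : v x₀ ≠ 0 := fun h => hux₀ (by rw [huv x₀ hx₀, h, mul_zero])
      have hx₀' : x₀ ∈ Ioo (-ℓ) ℓ := by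
        refine ⟨hx₀.1.lt_of_ne ?_, hx₀.2.lt_of_ne ?_⟩
        · rintro rfl
          exact hvx₀ hvl
        · rintro rfl
          exact hvx₀ hvr
      -- With the parameter real, the complex solution is a multiple of the real Prüfer solution, so
      -- `sin (Θ μ ℓ) = 0`.
      obtain ⟨μ, hμ, hzμ⟩ := hvq.exists_pos_of_ends_eq_zero hpos hvl hvr ⟨x₀, hx₀', hvx₀⟩
      rw [hzμ] at hvq
      obtain ⟨ρ, hρ1, hρ, hs⟩ := hsol μ
      have heq := hvq.eq_const_mul hlt.le hp hpos hvl hs.ofReal (by simp [(hΘ μ).init])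
        (by simp [(hΘ μ).init, hρ1])
      have hq0 : q (-ℓ) ≠ 0 := fun h => hvx₀ (by rw [heq x₀ hx₀, h, zero_mul])
      have h1 := heq ℓ (right_mem_Icc.2 hlt.le)
      rw [hvr] at h1
      have h2 : ρ ℓ * Real.sin (Θ μ ℓ) = 0 := by
        exact_mod_cast (mul_eq_zero.1 h1.symm).resolve_left hq0
      obtain ⟨k, hk⟩ := hall μ hμ ((mul_eq_zero.1 h2).resolve_left (hρ ℓ).ne')
      refine ⟨k, ?_⟩
      simp only [hk]
      push_cast
      rw [← hzμ]
      field_simp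
  · intro k u u' hu hu'
    obtain ⟨ρ, hρ1, hρ, hs⟩ := hsol (m k)
    have hform : ∀ {u : ℝ → ℂ}, IsDirichletEigenfunction ℓ ε a ((-(ε * m k) : ℝ) : ℂ) u →
        ∃ c : ℂ, ∀ x ∈ Icc (-ℓ) ℓ, u x = c * (p x * (ρ x * Real.sin (Θ (m k) x) : ℝ)) := by
      intro u hu
      obtain ⟨v, q, hvq, huv⟩ := hu.exists_solution hℓ hε hp hpos hpd
      have hvl : v (-ℓ) = 0 := by
        have := huv _ (left_mem_Icc.2 hlt.le)
        rw [hu.boundary_left] at this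
        exact (mul_eq_zero.1 this.symm).resolve_left (by exact_mod_cast (hpos _).ne')
      have hz : -((-(ε * m k) : ℝ) : ℂ) / ε = (m k : ℂ) := by
        push_cast
        field_simp
      rw [hz] at hvq
      have heq := hvq.eq_const_mul hlt.le hp hpos hvl hs.ofReal (by simp [(hΘ _).init])
        (by simp [(hΘ _).init, hρ1])
      refine ⟨q (-ℓ), fun x hx => ?_⟩
      rw [huv x hx, heq x hx]
      ring
    obtain ⟨c, hc⟩ := hform hu
    obtain ⟨c', hc'⟩ := hform hu'
    have hc0 : c ≠ 0 := by
      rintro rfl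
      obtain ⟨x, hx, hux⟩ := hu.nonzero
      exact hux (by rw [hc x hx, zero_mul])
    refine ⟨c' / c, fun x hx => ?_⟩
    rw [hc x hx, hc' x hx]
    field_simp

/-! ### Estimates for a transition layer. -/

/-- Dirichlet eigenvalues on an interval on one side of the peak `ξ` of the weight are of order at
least `1 / ε²`. The sign `σ` tells the side. -/
lemma IsSturmLiouvilleSolution.le_of_one_side {p a y Y : ℝ → ℝ} {ε μ l r ξ σ c c₀ s κ : ℝ}
    (h : IsSturmLiouvilleSolution p μ l r y Y) (hε : 0 < ε) (hpos : ∀ x, 0 < p x)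
    (hpd : ∀ x ∈ Icc l r, HasDerivAt p (a x / ε * p x) x)
    (hl : y l = 0) (hr : y r = 0) (hne : ∃ x ∈ Ioo l r, y x ≠ 0) (hσ : σ ^ 2 = 1)
    (hside : ∀ x ∈ Ioo l r, 0 ≤ σ * (x - ξ)) (hsgn : ∀ x ∈ Ioo l r, σ * a x ≤ 0)
    (hout : ∀ x ∈ Ioo l r, c₀ * ε ≤ σ * (x - ξ) → σ * a x ≤ -c)
    (hc₀ : 0 < c₀) (hs : 0 < s) (hsc : 4 * s ≤ c) (hκc : 2 * κ ≤ s * c)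
    (hκ : 4 * s ^ 2 + κ ≤ s * Real.exp (-1) / c₀) : κ / ε ^ 2 ≤ μ := by
  have hEd : ∀ x, HasDerivAt (fun x => s * (1 + Real.exp (-(σ * (x - ξ)) / (c₀ * ε))))
      (s * (Real.exp (-(σ * (x - ξ)) / (c₀ * ε)) * (-σ / (c₀ * ε)))) x := fun x => by
    refine (((((hasDerivAt_id x).sub_const ξ).const_mul σ).neg.div_const (c₀ * ε)).exp.const_add
      1).const_mul s |>.congr_deriv ?_
    simp
  refine h.le_of_riccati hpos hl hr hne
    -- With `S = (σ / ε) p T`, the Riccati inequality divided by `p / ε²` reads `σ a T + ε σ T' + T²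
    -- + κ ≤ 0`. Outside the layer `σ a ≤ -c` suffices. Inside, where `a` may vanish, the
    -- exponential in `T`, decaying on the scale `c₀ ε`, contributes at most `-s exp (-1) / c₀`.
    (S := fun x => σ / ε * (p x * (s * (1 + Real.exp (-(σ * (x - ξ)) / (c₀ * ε))))))
    (fun x hx => ((hpd x hx).mul (hEd x)).const_mul (σ / ε)) fun x hx => ?_
  set e := Real.exp (-(σ * (x - ξ)) / (c₀ * ε)) with he
  have he0 : 0 < e := Real.exp_pos _
  have hcε : 0 < c₀ * ε := mul_pos hc₀ hε
  have he1 : e ≤ 1 := by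
    rw [he, Real.exp_le_one_iff]
    exact div_nonpos_of_nonpos_of_nonneg (by linarith [hside x hx]) hcε.le
  have hfac : σ / ε * (a x / ε * p x * (s * (1 + e)) + p x * (s * (e * (-σ / (c₀ * ε))))) +
      (σ / ε * (p x * (s * (1 + e)))) ^ 2 / p x + κ / ε ^ 2 * p x =
      p x / ε ^ 2 * (σ * a x * (s * (1 + e)) - s * e / c₀ + (s * (1 + e)) ^ 2 + κ) := by
    have := (hpos x).ne'
    field_simp
    linear_combination (s * (c₀ * s * (1 + e) ^ 2 - e)) * hσ
  rw [hfac]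
  refine mul_nonpos_of_nonneg_of_nonpos (div_nonneg (hpos x).le (by positivity)) ?_
  have hs1 : s ≤ s * (1 + e) := by nlinarith
  have hs2 : s * (1 + e) ≤ 2 * s := by nlinarith
  rcases le_or_gt (c₀ * ε) (σ * (x - ξ)) with hx' | hx'
  · have h1 := hout x hx hx'
    have h2 : 0 ≤ s * e / c₀ := by positivity
    have h3 : σ * a x * (s * (1 + e)) ≤ -c * (s * (1 + e)) := by gcongr
    nlinarith
  · have h1 : σ * a x * (s * (1 + e)) ≤ 0 :=
      mul_nonpos_of_nonpos_of_nonneg (hsgn x hx) (hs.le.trans hs1)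
    have h2 : s * Real.exp (-1) / c₀ ≤ s * e / c₀ := by
      gcongr
      rw [he, Real.exp_le_exp, le_div_iff₀ hcε]
      linarith
    have h3 : (s * (1 + e)) ^ 2 ≤ (2 * s) ^ 2 := by gcongr
    linarith

/-- The angle takes the value `π` at an interior `z`, a zero of the solution. Whichever of `[l, z]`
and `[z, r]` avoids the interior of the other side of `ξ` carries a one-sided Dirichlet problem. -/
lemma IsPrueferAngle.le_of_pi_lt {p a θ : ℝ → ℝ} {ε μ l r ξ c c₀ s κ : ℝ}
    (hθ : IsPrueferAngle p μ l r θ) (hlr : l < r) (hε : 0 < ε) (hp : Continuous p)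
    (hpos : ∀ x, 0 < p x)
    (hpd : ∀ x ∈ Icc l r, HasDerivAt p (a x / ε * p x) x)
    (hpi : Real.pi < θ r) (hr : Real.sin (θ r) = 0)
    (hleft : ∀ x ∈ Ioo l r, x < ξ → 0 ≤ a x ∧ (c₀ * ε ≤ ξ - x → c ≤ a x))
    (hright : ∀ x ∈ Ioo l r, ξ < x → a x ≤ 0 ∧ (c₀ * ε ≤ x - ξ → a x ≤ -c))
    (hc₀ : 0 < c₀) (hs : 0 < s) (hsc : 4 * s ≤ c) (hκc : 2 * κ ≤ s * c)
    (hκ : 4 * s ^ 2 + κ ≤ s * Real.exp (-1) / c₀) : κ / ε ^ 2 ≤ μ := by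
  obtain ⟨ρ, -, hρ, hsol⟩ := hθ.exists_solution hlr.le hp hpos
  obtain ⟨z, hz, hzπ⟩ := intermediate_value_Ioo hlr.le hθ.continuousOn
    (⟨by rw [hθ.init]; exact Real.pi_pos, hpi⟩ : Real.pi ∈ Ioo (θ l) (θ r))
  rcases le_total ξ z with hξ | hξ
  · obtain ⟨x, hx, hne⟩ := hθ.exists_sin_ne_zero hpos hz.1.le hz.2 le_rfl
    refine (hsol.mono hz.1.le le_rfl).le_of_one_side (σ := 1) (ξ := ξ) hε hpos
      (fun x hx => hpd x ⟨hz.1.le.trans hx.1, hx.2⟩) (by simp [hzπ]) (by simp [hr])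
      ⟨x, hx, mul_ne_zero (hρ x).ne' hne⟩ (by norm_num) (fun x hx => by linarith [hx.1])
      (fun x hx => ?_) (fun x hx hx' => ?_) hc₀ hs hsc hκc hκ
    · rw [one_mul]
      exact (hright x ⟨hz.1.trans hx.1, hx.2⟩ (hξ.trans_lt hx.1)).1
    · rw [one_mul] at hx' ⊢
      exact (hright x ⟨hz.1.trans hx.1, hx.2⟩ (hξ.trans_lt hx.1)).2 hx'
  · obtain ⟨x, hx, hne⟩ := hθ.exists_sin_ne_zero hpos le_rfl hz.1 hz.2.le
    refine (hsol.mono le_rfl hz.2.le).le_of_one_side (σ := -1) (ξ := ξ) hε hpos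
      (fun x hx => hpd x ⟨hx.1, hx.2.trans hz.2.le⟩) (by simp [hθ.init]) (by simp [hzπ])
      ⟨x, hx, mul_ne_zero (hρ x).ne' hne⟩ (by norm_num) (fun x hx => by linarith [hx.2])
      (fun x hx => ?_) (fun x hx hx' => ?_) hc₀ hs hsc hκc hκ
    · linarith [(hleft x ⟨hx.1, hx.2.trans hz.2⟩ (hx.2.trans_le hξ)).1]
    · linarith [(hleft x ⟨hx.1, hx.2.trans hz.2⟩ (hx.2.trans_le hξ)).2 (by linarith)]

/-- An angle ending at `π` stays in `(0, π)` inside, since multiples of `π` are crossed only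
upwards; the eigenfunction is therefore positive. -/
lemma IsPrueferAngle.mul_le_of_eq_pi {p θ : ℝ → ℝ} {μ l r : ℝ}
    (hθ : IsPrueferAngle p μ l r θ) (hlr : l < r) (hp : Continuous p) (hpos : ∀ x, 0 < p x)
    (hμ : 0 ≤ μ) (hpi : θ r = Real.pi)
    {β s t γ c P Q : ℝ} (hβ : l < β) (hβs : β ≤ s) (hst : s ≤ t) (htγ : t ≤ γ) (hγ : γ < r)
    (hc : ∀ x ∈ Icc s t, c ≤ p x) (hP : ∀ x ∈ Icc l β, p x ≤ P) (hQ : ∀ x ∈ Icc γ r, p x ≤ Q) :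
    μ * c * (t - s) ≤ P / (β - l) + Q / (r - γ) := by
  obtain ⟨ρ, -, hρ, hsol⟩ := hθ.exists_solution hlr.le hp hpos
  refine hsol.mul_le_of_pos hpos hμ (by simp [hθ.init]) (by simp [hpi]) (fun x hx => ?_)
    hβ hβs hst htγ hγ hc hP hQ
  refine mul_pos (hρ x) (Real.sin_pos_of_pos_of_lt_pi (hθ.pos hp hpos ⟨hx.1, hx.2.le⟩) ?_)
  by_contra! h
  exact (hθ.lt_of_le_of_sin_eq_zero hp hpos Real.sin_pi (Ioo_subset_Icc_self hx)
    (right_mem_Icc.2 hlr.le) hx.2 h).ne' hpi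

/-- Between `ξ - 2 d` and `ξ - d` the function gains at least `c d`, and it never decreases towards
its value `0` at `ξ`. Applied to `A`, it makes `p` exponentially small away from the peak. -/
lemma le_neg_mul_of_deriv_ge {l ξ d c : ℝ} {f f' : ℝ → ℝ}
    (hf : ∀ x ∈ Icc l ξ, HasDerivAt f (f' x) x) (h0 : ∀ x ∈ Ioo l ξ, 0 ≤ f' x)
    (hd : 0 ≤ d) (hc : 0 ≤ c) (hfc : ∀ x ∈ Ioo l ξ, d ≤ ξ - x → c ≤ f' x) (hξ : f ξ = 0) :
    ∀ x ∈ Icc l (ξ - 2 * d), f x ≤ -(c * d) := by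
  intro x hx
  have hx1 : x ≤ ξ - d := by linarith [hx.2]
  have h1 := monotoneOn_Icc_of_hasDerivAt hf h0 (⟨hx.1.trans hx1, by linarith⟩ : ξ - d ∈ Icc l ξ)
    (⟨by linarith [hx.1], le_rfl⟩ : ξ ∈ Icc l ξ) (by linarith)
  have h2 := monotoneOn_Icc_of_hasDerivAt (l := l) (r := ξ - d) (f := fun x => f x - c * x)
    (fun x hx => (hf x ⟨hx.1, by linarith [hx.2]⟩).sub ((hasDerivAt_id x).const_mul c))
    (fun x hx => by
      have := hfc x ⟨hx.1, by linarith [hx.2]⟩ (by linarith [hx.2])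
      linarith) ⟨hx.1, hx1⟩ ⟨hx.1.trans hx1, le_rfl⟩ hx1
  simp only at h2
  nlinarith [hx.2]

/-- The estimates of the eigenvalues for a single `ε`. -/
theorem exists_isEigenvalueSequence_of_layer {ℓ ξ ε c c₀ d M s κ : ℝ} {a : ℝ → ℝ}
    (hε : 0 < ε) (hξ : ξ ∈ Ioo (-ℓ) ℓ) (ha : ContinuousOn a (Icc (-ℓ) ℓ))
    (hleft : ∀ x ∈ Ioo (-ℓ) ℓ, x < ξ → 0 ≤ a x ∧ (c₀ * ε ≤ ξ - x → c ≤ a x))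
    (hright : ∀ x ∈ Ioo (-ℓ) ℓ, ξ < x → a x ≤ 0 ∧ (c₀ * ε ≤ x - ξ → a x ≤ -c))
    (hM : ∀ x ∈ Icc (-ℓ) ℓ, |a x| ≤ M) (hd : 0 < d) (hdl : 4 * d ≤ ξ + ℓ) (hdr : 4 * d ≤ ℓ - ξ)
    (hεd : ε ≤ d) (hc₀d : c₀ * ε ≤ d)
    (hc₀ : 0 < c₀) (hs : 0 < s) (hsc : 4 * s ≤ c) (hκc : 2 * κ ≤ s * c)
    (hκ : 4 * s ^ 2 + κ ≤ s * Real.exp (-1) / c₀) :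
    ∃ lam : ℕ+ → ℝ, IsEigenvalueSequence ℓ ε a lam ∧
      (-(Real.exp M / d * Real.exp (-(c * d) / ε)) ≤ lam 1 ∧ lam 1 < 0) ∧
      ∀ k : ℕ+, 2 ≤ k → lam k ≤ -κ / ε := by
  have hlt : -ℓ < ℓ := hξ.1.trans hξ.2
  have hℓ : 0 < ℓ := by linarith
  have hξ' := Ioo_subset_Icc_self hξ
  have hc : 0 < c := by linarith
  have hbc : Continuous (IccExtend hlt.le ((Icc (-ℓ) ℓ).domRestrict a)) :=
    ha.domRestrict.Icc_extend'
  set A : ℝ → ℝ := fun x => ∫ t in ξ..x, IccExtend hlt.le ((Icc (-ℓ) ℓ).domRestrict a) t with hA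
  have hAd' : ∀ x, HasDerivAt A (IccExtend hlt.le ((Icc (-ℓ) ℓ).domRestrict a) x) x := fun x =>
    (hbc.integral_hasStrictDerivAt ξ x).hasDerivAt
  have hAd : ∀ x ∈ Icc (-ℓ) ℓ, HasDerivAt A (a x) x := fun x hx => by
    have := hAd' x
    rwa [IccExtend_of_mem _ _ hx, domRestrict_apply] at this
  have hAξ : A ξ = 0 := by simp [hA]
  have hAc : Continuous A := continuous_iff_continuousAt.2 fun x => (hAd' x).continuousAt
  set p : ℝ → ℝ := fun x => Real.exp (A x / ε) with hp
  have hpc : Continuous p := by fun_prop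
  have hpos : ∀ x, 0 < p x := fun x => Real.exp_pos _
  have hpd : ∀ x ∈ Icc (-ℓ) ℓ, HasDerivAt p (a x / ε * p x) x := fun x hx => by
    rw [mul_comm]
    exact ((hAd x hx).div_const ε).exp
  obtain ⟨lam, hlam, hall⟩ := exists_isEigenvalueSequence hℓ hε hpc hpos
    fun x hx => hpd x (Ioo_subset_Icc_self hx)
  refine ⟨lam, hlam, ?_, fun k hk => ?_⟩
  · obtain ⟨μ, θ, hμ, hlamμ, hθ, hθπ⟩ := hall 1
    have hP : ∀ x ∈ Icc (-ℓ) (ξ - 2 * d), p x ≤ Real.exp (-(c * d) / ε) := fun x hx => by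
      refine Real.exp_le_exp.2 (div_le_div_of_nonneg_right ?_ hε.le)
      exact le_neg_mul_of_deriv_ge (l := -ℓ) (ξ := ξ)
        (fun x hx => hAd x ⟨hx.1, hx.2.trans hξ.2.le⟩)
        (fun x hx => (hleft x ⟨hx.1, hx.2.trans hξ.2⟩ hx.2).1) hd.le hc.le
        (fun x hx hx' => (hleft x ⟨hx.1, hx.2.trans hξ.2⟩ hx.2).2 (hc₀d.trans hx')) hAξ x hx
    have hQ : ∀ x ∈ Icc (ξ + 2 * d) ℓ, p x ≤ Real.exp (-(c * d) / ε) := fun x hx => by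
      refine Real.exp_le_exp.2 (div_le_div_of_nonneg_right ?_ hε.le)
      -- The right side is reduced to the left one by the reflection `x ↦ -x`.
      have := le_neg_mul_of_deriv_ge (l := -ℓ) (ξ := -ξ) (f := fun x => A (-x))
        (f' := fun x => -a (-x)) (d := d) (c := c) (fun x hx => by
          have := (hAd (-x) ⟨by linarith [hx.2, hξ.1], by linarith [hx.1]⟩).comp x (hasDerivAt_neg x)
          rwa [mul_neg_one] at this)
        (fun x hx => by
          linarith [(hright (-x) ⟨by linarith [hx.2, hξ.1], by linarith [hx.1]⟩
            (by linarith [hx.2])).1]) hd.le hc.le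
        (fun x hx hx' => by
          linarith [(hright (-x) ⟨by linarith [hx.2, hξ.1], by linarith [hx.1]⟩
            (by linarith [hx.2])).2 (by linarith)]) (by simp [hAξ]) (-x)
        ⟨by linarith [hx.2], by linarith [hx.1]⟩
      simpa using this
    -- On a window of length `ε` the bound `|a| ≤ M` gives `A ≥ -M ε`, so `p` stays bounded below
    -- independently of `ε`.
    have hcl : ∀ x ∈ Icc ξ (ξ + ε), Real.exp (-M) ≤ p x := fun x hx => by
      refine Real.exp_le_exp.2 ?_
      rw [le_div_iff₀ hε]
      have h1 := monotoneOn_Icc_of_hasDerivAt (l := ξ) (r := ξ + ε) (f := fun x => A x + M * x)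
        (fun x hx => (hAd x ⟨by linarith [hx.1, hξ.1], by linarith [hx.2]⟩).add
          ((hasDerivAt_id x).const_mul M)) (fun x hx => by
          have := neg_le_of_abs_le (hM x ⟨by linarith [hx.1, hξ.1], by linarith [hx.2]⟩)
          linarith) (left_mem_Icc.2 (by linarith)) hx hx.1
      have hM0 : 0 ≤ M := (abs_nonneg _).trans (hM ξ hξ')
      simp only [hAξ] at h1
      nlinarith [hx.2]
    have hmain := hθ.mul_le_of_eq_pi hlt hpc hpos hμ.le (by simpa using hθπ)
      (β := ξ - 2 * d) (s := ξ) (t := ξ + ε) (γ := ξ + 2 * d) (by linarith) (by linarith)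
      (by linarith) (by linarith) (by linarith) hcl hP hQ
    set E := Real.exp (-(c * d) / ε) with hE
    have hE0 : 0 < E := Real.exp_pos _
    have h1 : E / (ξ - 2 * d - -ℓ) ≤ E / (2 * d) := by gcongr; linarith
    have h2 : E / (ℓ - (ξ + 2 * d)) ≤ E / (2 * d) := by gcongr; linarith
    have h3 : E / (2 * d) + E / (2 * d) = E / d := by field_simp; ring
    have h4 : μ * Real.exp (-M) * ε ≤ E / d := by linarith
    have h5 : Real.exp M * Real.exp (-M) = 1 := by rw [← Real.exp_add]; simp
    refine ⟨?_, ?_⟩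
    · rw [hlamμ, neg_le_neg_iff]
      calc ε * μ = Real.exp M * (μ * Real.exp (-M) * ε) := by linear_combination (-ε * μ) * h5
        _ ≤ Real.exp M * (E / d) := by gcongr
        _ = _ := by ring
    · rw [hlamμ]
      exact neg_lt_zero.2 (mul_pos hε hμ)
  · obtain ⟨μ, θ, hμ, hlamμ, hθ, hθπ⟩ := hall k
    have hk' : (2 : ℝ) ≤ k := by exact_mod_cast hk
    have hκμ := hθ.le_of_pi_lt hlt hε hpc hpos hpd
      (by rw [hθπ]; nlinarith [Real.pi_pos]) (by rw [hθπ]; exact Real.sin_nat_mul_pi _)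
      hleft hright hc₀ hs hsc hκc hκ
    rw [div_le_iff₀ (by positivity)] at hκμ
    rw [hlamμ, le_div_iff₀ hε]
    linarith

theorem corollary4p4 (ℓ ξ aL aR εbar : ℝ) (hℓ : 0 < ℓ) (hξ : ξ ∈ Set.Ioo (-ℓ) ℓ)
    (haR : aR < 0) (haL : 0 < aL) (hεbar : 0 < εbar) (a : ℝ → ℝ → ℝ)
    (h0 : UniformlyBoundedFamily ℓ ξ εbar a)
    (h1 : ∀ ε ∈ Set.Ioo 0 εbar, HasLayerShape ℓ ξ (a ε))
    (h2 : ConvergesOutsideLayer ℓ ξ aL aR εbar a)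
    (h3 : HasNondegenerateSlopes ξ εbar a) :
    ∃ C > 0, ∃ ε₀ > 0, ε₀ ≤ εbar ∧ ∀ ε ∈ Set.Ioo 0 ε₀,
      ∃ lam : ℕ+ → ℝ, IsEigenvalueSequence ℓ ε (a ε) lam ∧
        (-C * Real.exp (-C / ε) ≤ lam 1 ∧ lam 1 < 0) ∧
        ∀ k : ℕ+, 2 ≤ k → lam k ≤ -C / ε := by
  obtain ⟨M, -, hM⟩ := h0
  set c := min aL (-aR) / 2 with hcdef
  have hc : 0 < c := half_pos (lt_min haL (by linarith))
  have hcL : 2 * c ≤ aL := by rw [hcdef]; linarith [min_le_left aL (-aR)]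
  have hcR : 2 * c ≤ -aR := by rw [hcdef]; linarith [min_le_right aL (-aR)]
  obtain ⟨c₀, hc₀, hlayer⟩ := h2 c hc
  set d := min (ξ + ℓ) (ℓ - ξ) / 4 with hddef
  have hd : 0 < d := div_pos (lt_min (by linarith [hξ.1]) (by linarith [hξ.2])) (by norm_num)
  have hdl : 4 * d ≤ ξ + ℓ := by rw [hddef]; linarith [min_le_left (ξ + ℓ) (ℓ - ξ)]
  have hdr : 4 * d ≤ ℓ - ξ := by rw [hddef]; linarith [min_le_right (ξ + ℓ) (ℓ - ξ)]
  set e := Real.exp (-1) / c₀ with hedef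
  have he : 0 < e := div_pos (Real.exp_pos _) hc₀
  -- With `s ≤ e / 8` and `κ ≤ s e / 2`, each of `4 s²` and `κ` takes at most half of `s e`.
  set s := min (c / 4) (e / 8) with hsdef
  have hs : 0 < s := lt_min (by linarith) (by linarith)
  have hsc : 4 * s ≤ c := by linarith [min_le_left (c / 4) (e / 8)]
  have hse : 8 * s ≤ e := by linarith [min_le_right (c / 4) (e / 8)]
  set κ := min (s * c / 2) (s * e / 2) with hκdef
  have hκ0 : 0 < κ := lt_min (by positivity) (by positivity)
  have hκc : 2 * κ ≤ s * c := by linarith [min_le_left (s * c / 2) (s * e / 2)]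
  have hκe : 2 * κ ≤ s * e := by linarith [min_le_right (s * c / 2) (s * e / 2)]
  have hκ : 4 * s ^ 2 + κ ≤ s * Real.exp (-1) / c₀ := by
    rw [mul_div_assoc, ← hedef]
    nlinarith
  -- Half of the decay rate `c d` is kept for the final exponential; the other half absorbs the
  -- prefactor `K`.
  set w := c * d / 2 with hwdef
  have hw : 0 < w := by positivity
  set C := min κ w with hCdef
  have hC : 0 < C := lt_min hκ0 hw
  set K := Real.exp M / d with hKdef
  have hK : 0 < K := div_pos (Real.exp_pos _) hd
  -- The bounds by `d` and `d / c₀` fit the window and the layer within distance `d` of `ξ`; the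
  -- last one gives `K exp (-w / ε) ≤ K ε / w ≤ C`.
  refine ⟨C, hC, min εbar (min d (min (d / c₀) (C * w / K))), by positivity, min_le_left _ _, ?_⟩
  rintro ε ⟨hε, hεlt⟩
  obtain ⟨hε1, hεlt⟩ := lt_min_iff.1 hεlt
  obtain ⟨hε2, hεlt⟩ := lt_min_iff.1 hεlt
  obtain ⟨hε3, hε4⟩ := lt_min_iff.1 hεlt
  have hεmem : ε ∈ Ioo 0 εbar := ⟨hε, hε1⟩
  have hshape := h1 ε hεmem
  obtain ⟨lam, hlam, ⟨hl1, hl0⟩, hl2⟩ := exists_isEigenvalueSequence_of_layer (M := M) hε hξ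
    hshape.continuousOn (c := c) (c₀ := c₀) (d := d) (s := s) (κ := κ)
    (fun x hx hxξ => ⟨(hshape.left x ⟨hx.1, hxξ⟩).2.2.le, fun hx' => by
      have := (hlayer ε hεmem x hx (by rwa [abs_sub_comm, abs_of_pos (by linarith)])).1
      rw [stepCoeff, if_pos hxξ] at this
      linarith [neg_le_of_abs_le this]⟩)
    (fun x hx hxξ => ⟨(hshape.right x ⟨hxξ, hx.2⟩).1.le, fun hx' => by
      have := (hlayer ε hεmem x hx (by rwa [abs_of_pos (by linarith)])).1
      rw [stepCoeff, if_neg (not_lt.2 hxξ.le)] at this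
      linarith [le_of_abs_le this]⟩)
    (fun x hx => by
      have := hM ε hεmem x hx ((ξ + ℓ) / 2) ⟨by linarith [hξ.1], by linarith [hξ.2]⟩
        (by linarith [hξ.2])
      have h' : 0 ≤ ε * |deriv (a ε) ((ξ + ℓ) / 2)| := by positivity
      linarith)
    hd hdl hdr hε2.le (by rw [lt_div_iff₀ hc₀] at hε3; linarith) hc₀ hs hsc hκc hκ
  refine ⟨lam, hlam, ⟨?_, hl0⟩, fun k hk => (hl2 k hk).trans ?_⟩
  · refine le_trans ?_ hl1
    rw [neg_mul, neg_le_neg_iff]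
    have hexp : Real.exp (-(c * d) / ε) = Real.exp (-w / ε) * Real.exp (-w / ε) := by
      rw [← Real.exp_add]
      congr 1
      rw [hwdef]
      ring
    have hle1 : Real.exp (-w / ε) ≤ ε / w := by
      rw [neg_div, Real.exp_neg, ← inv_div w ε]
      exact inv_anti₀ (by positivity) (by linarith [Real.add_one_le_exp (w / ε)])
    have hle2 : Real.exp (-w / ε) ≤ Real.exp (-C / ε) := by
      gcongr
      exact min_le_right _ _
    have hle3 : K * (ε / w) ≤ C := by
      rw [lt_div_iff₀ hK] at hε4
      rw [← mul_div_assoc, div_le_iff₀ hw]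
      linarith
    calc K * Real.exp (-(c * d) / ε) = K * Real.exp (-w / ε) * Real.exp (-w / ε) := by
          rw [hexp, mul_assoc]
      _ ≤ K * (ε / w) * Real.exp (-C / ε) := by gcongr
      _ ≤ C * Real.exp (-C / ε) := by gcongr
  · gcongr
    exact min_le_left _ _
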